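/- Let $M\subset\mathbb{R}^2$ be open and let $\Sigma\subset M$ be a smooth normal crossings variety: a finite union of closed smooth curves of $M$ such that near every point of $M$ there are local coordinates centred at the point in which $\Sigma$ is $\{x_1\cdots x_c=0\}$ for some $0\le c\le 2$ (empty if $c=0$). Let $X$ be a piecewise smooth vector field on $(M,\Sigma)$, i.e. $X$ is smooth on $M\setminus\Sigma$ and, for each connected component $W$ of $M\setminus\Sigma$, $X|_W$ extends to a smooth vector field on $M$. Let $m\ge 0$ be a mollifier on $\mathbb{R}^2$ (smooth, compactly supported, $\int m=1$), put $m_\varepsilon(x)=\varepsilon^{-2}m(x/\varepsilon)$, and let $X^{\mathrm{reg}}$ be the family with $X^{\mathrm{reg}}_\varepsilon=m_\varepsilon * X$ for $\varepsilon>0$ and $X^{\mathrm{reg}}_0=X$. Let $\gamma$ be a sewing-type periodic orbit of $X$ crossing $\Sigma$ at $p_1,\dots,p_k$, $k\ge 1$ (indices modulo $k$): $\gamma$ is a simple closed curve, the concatenation of arcs $\gamma_i:I_i=[0,T_i]\to M$, $T_i>0$, from $p_i\in\Sigma$ to $p_{i+1}\in\Sigma$, where the interior of $\gamma_i$ lies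 in a connected component $W_i$ of $M\setminus\Sigma$ and is a regular orbit of $X$ parametrized by the flow; each $p_i$ is a point at which $\Sigma$ has exactly one local component. Write $X_i$ for a smooth extension of $X|_{W_i}$ to $M$; assume that $X_i$ is transverse to $\Sigma$ (in particular non-zero) at $p_i$ and at $p_{i+1}$. Let $P_i:(\Sigma,p_i)\to(\Sigma,p_{i+1})$ be the transition map obtained by following the orbits of $X|_{W_i}$ from $\Sigma$ to $\Sigma$, and let $P=P_k\circ\cdots\circ P_1$ be the sewing Poincaré map at $p=p_1$. Fix a smooth regular injective parametrization $\sigma:(-\delta,\delta)\to\Sigma$ with $\sigma(0)=p$, of a piece of $\Sigma$ whose closure meets $\gamma$ only at $p$. Let $P^{\mathrm{reg}}(x,\varepsilon)$ be the regularized Poincaré map in the coordinate $x$ (the parameter $\varepsilon$ being preserved): $\sigma(P^{\mathrm{reg}}(x,0))=P(\sigma(x))$, and, for small $\varepsilon>0$, $P^{\mathrm{reg}}(\cdot,\varepsilon)$ is the Poincaré first return map of $m_\varepsilon * X$ to the section $\sigma((-\delta,\delta))$. For each $i$ choose a unit vector $\tau_i$ tangent to $\Sigma$ at $p_i$, and let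 $\theta_i^{\mathrm{in}}$ be the oriented angle from $\tau_i$ to $X_i(p_i)$ and $\theta_i^{\mathrm{out}}$ the oriented angle from $\tau_{i+1}$ to $X_i(p_{i+1})$. Then $x\mapsto P^{\mathrm{reg}}(x,0)$ is differentiable at $0$, and the partial derivative of $P^{\mathrm{reg}}$ with respect to $x$ at the origin $(x,\varepsilon)=(0,0)$ is $$\frac{dP^{\mathrm{reg}}}{dx}(0)=\prod_{i=1}^{k}\frac{\|X_i(p_i)\|\,\sin\theta_i^{\mathrm{in}}}{\|X_i(p_{i+1})\|\,\sin\theta_i^{\mathrm{out}}}\;\exp\int_0^{T_i}\operatorname{div}(X_i)(\gamma_i(t))\,dt .$$ -/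

import Mathlib

open scoped ContDiff

noncomputable section

namespace PlanarSewing

/-- The Euclidean plane. -/
abbrev Plane : Type := EuclideanSpace ℝ (Fin 2)

/-- The standard orientation of the plane. -/
def planeOrientation : Orientation ℝ Plane (Fin 2) :=
  (EuclideanSpace.basisFun (Fin 2) ℝ).toBasis.orientation

instance planeFinrank : Fact (Module.finrank ℝ Plane = 2) := ⟨by simp⟩

/-- Divergence of a planar vector field. -/
def divergence (Y : Plane → Plane) (x : Plane) : ℝ :=
  ∑ j : Fin 2, (fderiv ℝ Y x (EuclideanSpace.single j 1)) j

/-! ### Piecewise smooth spaces and piecewise smooth vector fields -/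

/-- `φ` is a smooth local coordinate system of the open set `M`, centred at `p`. -/
structure IsLocalChart (M : Set Plane) (p : Plane) (φ : OpenPartialHomeomorph Plane Plane) :
    Prop where
  mem_source : p ∈ φ.source
  source_subset : φ.source ⊆ M
  smooth : ContDiffOn ℝ ∞ φ φ.source
  smooth_symm : ContDiffOn ℝ ∞ φ.symm φ.target
  center : φ p = 0

/-- `φ` is a local coordinate system at `p` in which `S` is `{x₁ ⋯ x_c = 0}`
(the empty set for `c = 0`). -/
structure IsAdaptedChart (M S : Set Plane) (p : Plane) (c : ℕ)
    (φ : OpenPartialHomeomorph Plane Plane) : Prop extends IsLocalChart M p φ where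
  locus : ∀ x ∈ φ.source, x ∈ S ↔ ∃ i : Fin 2, (i : ℕ) < c ∧ φ x i = 0

/-- `C` is a smooth submanifold of codimension one of the open set `M`, closed in `M`. -/
structure IsSmoothCurveIn (M C : Set Plane) : Prop where
  subset : C ⊆ M
  closed : ∃ F : Set Plane, IsClosed F ∧ C = F ∩ M
  chart : ∀ p ∈ C, ∃ φ, IsAdaptedChart M C p 1 φ

/-- `S` is a smooth normal crossings variety in the open set `M` of the plane: a finite union of
smooth closed curves of `M` (possibly none) admitting adapted coordinates at every point. -/
structure IsNormalCrossings (M S : Set Plane) : Prop where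
  components : ∃ (N : ℕ) (C : Fin N → Set Plane),
    (∀ j, IsSmoothCurveIn M (C j)) ∧ S = ⋃ j, C j
  chart : ∀ p ∈ M, ∃ c ≤ 2, ∃ φ, IsAdaptedChart M S p c φ

/-- `W` is a connected component of `M \ S`. -/
def IsComplementComponent (M S W : Set Plane) : Prop :=
  ∃ x ∈ M \ S, W = connectedComponentIn (M \ S) x

/-- `Y` is smooth on `M` and extends the restriction of `X` to `W`. -/
structure IsSmoothExtension (M W : Set Plane) (X Y : Plane → Plane) : Prop where
  smooth : ContDiffOn ℝ ∞ Y M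
  eqOn : Set.EqOn X Y W

/-- `X` is a piecewise smooth vector field on `M` with discontinuity locus `S`.  The values of `X`
on `S` and outside `M` are irrelevant. -/
def IsPiecewiseSmooth (M S : Set Plane) (X : Plane → Plane) : Prop :=
  ContDiffOn ℝ ∞ X (M \ S) ∧
    ∀ W, IsComplementComponent M S W → ∃ Y, IsSmoothExtension M W X Y

/-- `p` is a point of exactly one local component of `S`, and `v` is tangent to `S` at `p`. -/
def IsTangentAt (M S : Set Plane) (p v : Plane) : Prop :=
  ∃ φ, IsAdaptedChart M S p 1 φ ∧ (fderiv ℝ φ p v) 0 = 0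

/-- `p` is a point of exactly one local component of `S`, and `v` is transverse to `S` at `p`. -/
def IsTransverseAt (M S : Set Plane) (p v : Plane) : Prop :=
  ∃ φ, IsAdaptedChart M S p 1 φ ∧ (fderiv ℝ φ p v) 0 ≠ 0

/-! ### Regularization by convolution -/

/-- Mollifiers in the plane. -/
structure IsMollifier (m : Plane → ℝ) : Prop where
  smooth : ContDiff ℝ ∞ m
  nonneg : ∀ x, 0 ≤ m x
  integral_eq_one : ∫ x, m x = 1
  compact_support : HasCompactSupport m

/-- The rescaled mollifier `m_ε(x) = ε⁻² m(x / ε)`. -/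
def rescaledMollifier (m : Plane → ℝ) (ε : ℝ) (x : Plane) : ℝ :=
  (ε ^ 2)⁻¹ * m (ε⁻¹ • x)

/-- The regularization by convolution `X^reg`: it is `m_ε * X` for `ε > 0` and `X` for `ε = 0`. -/
def regularizedField (m : Plane → ℝ) (X : Plane → Plane) (ε : ℝ) (x : Plane) : Plane :=
  if 0 < ε then ∫ y, rescaledMollifier m ε y • X (x - y) else X x

/-! ### Sewing-type periodic orbits -/

/-- A sewing-type periodic orbit of `X`, crossing `S` at `p 0, …, p (k - 1)` (indices modulo `k`):
a simple closed curve which is the concatenation of the arcs `arc i : [0, T i] → M` from `p i` to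
`p (i + 1)`.  The interior of `arc i` is a regular orbit of `X` in the component `W i` of
`M \ S`, the field `Xi i` is a smooth extension to `M` of the restriction of `X` to `W i`, and
each arc is transverse to `S` at both of its endpoints. -/
structure SewingOrbit (M S : Set Plane) (X : Plane → Plane) (k : ℕ) [NeZero k] where
  W : Fin k → Set Plane
  Xi : Fin k → Plane → Plane
  p : Fin k → Plane
  T : Fin k → ℝ
  arc : Fin k → ℝ → Plane
  W_component : ∀ i, IsComplementComponent M S (W i)
  Xi_extension : ∀ i, IsSmoothExtension M (W i) X (Xi i)
  p_mem : ∀ i, p i ∈ S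
  T_pos : ∀ i, 0 < T i
  arc_continuous : ∀ i, ContinuousOn (arc i) (Set.Icc 0 (T i))
  arc_start : ∀ i, arc i 0 = p i
  arc_end : ∀ i, arc i (T i) = p (i + 1)
  arc_interior : ∀ i, ∀ t ∈ Set.Ioo 0 (T i),
    arc i t ∈ W i ∧ X (arc i t) ≠ 0 ∧ HasDerivAt (arc i) (X (arc i t)) t
  transverse_start : ∀ i, IsTransverseAt M S (p i) (Xi i (p i))
  transverse_end : ∀ i, IsTransverseAt M S (p (i + 1)) (Xi i (p (i + 1)))
  simple : ∀ i j, ∀ s ∈ Set.Ico 0 (T i), ∀ t ∈ Set.Ico 0 (T j),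
    arc i s = arc j t → i = j ∧ s = t

variable {M S : Set Plane} {X : Plane → Plane} {k : ℕ} [NeZero k]

/-- The closed curve `γ` as a subset of the plane. -/
def SewingOrbit.range (γ : SewingOrbit M S X k) : Set Plane :=
  ⋃ i, γ.arc i '' Set.Icc 0 (γ.T i)

/-- The `i`-th transition map, as the set of pairs `(q, q')` with `P_i(q) = q'`: the orbit of the
restriction of `X` to `W i` starting at `q ∈ S` arrives at `q' ∈ S`. -/
def SewingOrbit.Transition (γ : SewingOrbit M S X k) (i : Fin k) (q q' : Plane) : Prop :=
  q ∈ S ∧ q' ∈ S ∧ ∃ (T : ℝ) (c : ℝ → Plane), 0 < T ∧ ContinuousOn c (Set.Icc 0 T) ∧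
    c 0 = q ∧ c T = q' ∧ ∀ t ∈ Set.Ioo 0 T, c t ∈ γ.W i ∧ HasDerivAt c (X (c t)) t

/-- The sewing Poincaré map `P = P_k ∘ ⋯ ∘ P_1`, as the set of pairs `(q, q')` with
`P(q) = q'`. -/
def SewingOrbit.SewingReturn (γ : SewingOrbit M S X k) (q q' : Plane) : Prop :=
  ∃ z : Fin (k + 1) → Plane, z 0 = q ∧ z (Fin.last k) = q' ∧
    ∀ i : Fin k, γ.Transition i (z i.castSucc) (z i.succ)

/-- The first return map of the vector field `Y` on `M` to the section `A`, as a set of pairs: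
the orbit of `Y` starting at `q` meets `A` again for the first time at `q'`. -/
def FirstReturn (M A : Set Plane) (Y : Plane → Plane) (q q' : Plane) : Prop :=
  q ∈ A ∧ q' ∈ A ∧ ∃ (T : ℝ) (c : ℝ → Plane), 0 < T ∧
    (∀ t ∈ Set.Icc 0 T, c t ∈ M ∧ HasDerivWithinAt c (Y (c t)) (Set.Icc 0 T) t) ∧
    c 0 = q ∧ c T = q' ∧ ∀ t ∈ Set.Ioo 0 T, c t ∉ A

/-- `σ : (-δ, δ) → S` is a smooth regular parametrization, with `σ 0 = p 0`, of a piece of `S`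
so small that its closure meets `γ` only at `p 0`. -/
structure IsSectionParam (γ : SewingOrbit M S X k) (σ : ℝ → Plane) (δ : ℝ) : Prop where
  pos : 0 < δ
  smooth : ContDiffOn ℝ ∞ σ (Set.Ioo (-δ) δ)
  injOn : Set.InjOn σ (Set.Ioo (-δ) δ)
  regular : ∀ x ∈ Set.Ioo (-δ) δ, deriv σ x ≠ 0
  mapsTo : Set.MapsTo σ (Set.Ioo (-δ) δ) S
  base : σ 0 = γ.p 0
  small : closure (σ '' Set.Ioo (-δ) δ) ∩ γ.range = {γ.p 0}

/-- `P^reg(x, ε) = y` in the coordinate `σ`: for `ε = 0` the point `σ y` is the image of `σ x` under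
the sewing Poincaré map of `γ`, and for `ε > 0` it is the image of `σ x` under the first return
map of `X^reg_ε = m_ε * X` to the section. -/
def SewingOrbit.RegReturn (γ : SewingOrbit M S X k) (m : Plane → ℝ) (σ : ℝ → Plane) (δ : ℝ)
    (x ε y : ℝ) : Prop :=
  x ∈ Set.Ioo (-δ) δ ∧ y ∈ Set.Ioo (-δ) δ ∧
    ((ε = 0 ∧ γ.SewingReturn (σ x) (σ y)) ∨
      (0 < ε ∧ FirstReturn M (σ '' Set.Ioo (-δ) δ) (regularizedField m X ε) (σ x) (σ y)))

open Classical in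
/-- The regularized Poincaré map `(x, ε) ↦ P^reg(x, ε)` in the coordinate `σ` of the section (the
parameter `ε` is preserved, so only the component along the section is recorded).  Where the orbit
does not return, the value is the irrelevant number `0`. -/
def SewingOrbit.regPoincare (γ : SewingOrbit M S X k) (m : Plane → ℝ) (σ : ℝ → Plane) (δ : ℝ)
    (x ε : ℝ) : ℝ :=
  if h : ∃ y, γ.RegReturn m σ δ x ε y then h.choose else 0

/-- The oriented angle at `p i` from the chosen unit tangent `τ i` of `S` to the arc `γ_i`. -/
def SewingOrbit.angleIn (γ : SewingOrbit M S X k) (τ : Fin k → Plane) (i : Fin k) : Real.Angle :=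
  planeOrientation.oangle (τ i) (γ.Xi i (γ.p i))

/-- The oriented angle at `p (i + 1)` from the chosen unit tangent `τ (i + 1)` of `S` to the
arc `γ_i`. -/
def SewingOrbit.angleOut (γ : SewingOrbit M S X k) (τ : Fin k → Plane) (i : Fin k) : Real.Angle :=
  planeOrientation.oangle (τ (i + 1)) (γ.Xi i (γ.p (i + 1)))

end PlanarSewing

end

open scoped ContDiff

noncomputable section

namespace PlanarSewing

open Set Filter Topology Metric Asymptotics

/-! ### The area form of the plane in coordinates -/

/-! On the slice ε = 0 the regularized map is the sewing map read in the coordinate `σ`, so the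
chain rule reduces the claim to one transition map at a time. Pairing with the unit tangent through
the area form `wedge` gives ‖X‖ sin θ, so each factor is a flux ratio times the Liouville
exponential.

For one arc `a` of a field `Z`, cut off to compact support, and a nearby orbit `b`, the quantity
`wedge (Z (a t)) (b t - a t)` satisfies the linear equation u' = div(Z) u up to a second-order
error. Grönwall and Taylor bounds turn this into `exists_wedge_displacement_bound`;
differentiability of the flow in its initial point is not needed. In `IsFlow.exists_landing` the
landing time is corrected: to first order this moves the end point along the field, which the area
form does not see, while the equation `f = 0` of the locus controls the transverse component.
`smul_eq_add_kerVec` recombines the two components into the derivative of the landing map.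

`SewingOrbit.exists_transition_map` shows that landing really is the transition map on `S`, and that
its derivative sends `τ i` to a factor times `τ (i + 1)`. Around the orbit the tangents return to `τ
0`, so the factors multiply. Since `regPoincare` is defined by choice,
`SewingOrbit.regPoincare_zero_eq` is needed to identify its value. -/

/-- The standard area form of the plane. -/
def wedge (u v : Plane) : ℝ := u 0 * v 1 - u 1 * v 0

theorem areaForm_eq_wedge (u v : Plane) : planeOrientation.areaForm u v = wedge u v := by
  rw [Orientation.areaForm_to_volumeForm,
    planeOrientation.volumeForm_robust (EuclideanSpace.basisFun (Fin 2) ℝ) rfl,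
    Module.Basis.det_apply, Matrix.det_fin_two]
  simp [Module.Basis.toMatrix_apply, wedge]
  ring

theorem abs_wedge_le (u v : Plane) : |wedge u v| ≤ ‖u‖ * ‖v‖ := by
  rw [← areaForm_eq_wedge]
  exact planeOrientation.abs_areaForm_le u v

/-- Translates ‖X‖ sin θ into the area form, the imaginary part of the Kähler form. For `v = 0` the
angle is a default value, but both sides vanish. -/
theorem norm_mul_sin_oangle {u v : Plane} (hu : ‖u‖ = 1) :
    ‖v‖ * (planeOrientation.oangle u v).sin = wedge u v := by
  rw [← areaForm_eq_wedge, Orientation.oangle, Real.Angle.sin_coe, Complex.sin_arg,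
    Orientation.norm_kahler, hu, one_mul, Orientation.kahler_apply_apply]
  rcases eq_or_ne v 0 with rfl | hv
  · simp
  · simp [mul_div_cancel₀, hv]

theorem wedge_swap (u v : Plane) : wedge u v = -wedge v u := by
  simp [wedge]; ring

/-- The area form as a linear form in its second argument. -/
def wedgeL (u : Plane) : Plane →L[ℝ] ℝ :=
  u 0 • EuclideanSpace.proj 1 - u 1 • EuclideanSpace.proj 0

@[simp] theorem wedgeL_apply (u v : Plane) : wedgeL u v = wedge u v := by
  simp [wedgeL, wedge]

theorem clm_apply_eq {F : Type*} [NormedAddCommGroup F] [NormedSpace ℝ F]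
    (A : Plane →L[ℝ] F) (w : Plane) :
    A w = w 0 • A (EuclideanSpace.single 0 1) + w 1 • A (EuclideanSpace.single 1 1) := by
  rw [← map_smul, ← map_smul, ← map_add]
  congr 1
  ext j
  fin_cases j <;> simp

/-- The infinitesimal form of Liouville's formula: a linear map acts on the area form as a
derivation, through its trace. With `A` the derivative of a field, the trace is the divergence. -/
theorem wedge_trace (A : Plane →L[ℝ] Plane) (u w : Plane) :
    wedge (A u) w + wedge u (A w) =
      (∑ j : Fin 2, (A (EuclideanSpace.single j 1)) j) * wedge u w := by
  rw [clm_apply_eq A u, clm_apply_eq A w, Fin.sum_univ_two]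
  simp only [wedge, PiLp.add_apply, PiLp.smul_apply, smul_eq_mul]
  ring

/-- Rotation of the gradient of a linear form: a spanning vector of its kernel. -/
def kerVec (ℓ : Plane →L[ℝ] ℝ) : Plane :=
  !₂[-ℓ (EuclideanSpace.single 1 1), ℓ (EuclideanSpace.single 0 1)]

/-- Decomposition of a vector along a vector `Y` and the kernel of a linear form `ℓ`. -/
theorem smul_eq_add_kerVec (ℓ : Plane →L[ℝ] ℝ) (Y w : Plane) :
    ℓ Y • w = ℓ w • Y + wedge Y w • kerVec ℓ := by
  rw [clm_apply_eq ℓ Y, clm_apply_eq ℓ w]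
  ext j
  fin_cases j <;> simp [kerVec, wedge] <;> ring

theorem apply_kerVec (ℓ : Plane →L[ℝ] ℝ) : ℓ (kerVec ℓ) = 0 := by
  rw [clm_apply_eq]
  simp [kerVec, mul_comm]

theorem wedge_kerVec (ℓ : Plane →L[ℝ] ℝ) (Y : Plane) : wedge Y (kerVec ℓ) = ℓ Y := by
  rw [clm_apply_eq ℓ Y]
  simp [kerVec, wedge]

/-- Two vectors in the kernel of a linear form are proportional. -/
theorem eq_smul_of_mem_ker {ℓ : Plane →L[ℝ] ℝ} {Y w v : Plane} (hY : ℓ Y ≠ 0) (hw : ℓ w = 0)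
    (hw0 : w ≠ 0) (hv : ℓ v = 0) :
    wedge Y w ≠ 0 ∧ v = (wedge Y v / wedge Y w) • w := by
  have h1 := smul_eq_add_kerVec ℓ Y w
  have h2 := smul_eq_add_kerVec ℓ Y v
  rw [hw, zero_smul, zero_add] at h1
  rw [hv, zero_smul, zero_add] at h2
  have h3 : wedge Y w ≠ 0 := by
    intro h
    rw [h, zero_smul, smul_eq_zero] at h1
    tauto
  refine ⟨h3, ?_⟩
  have h4 : ℓ Y • (wedge Y w • v) = ℓ Y • (wedge Y v • w) := by
    rw [smul_comm, h2, smul_comm (ℓ Y), h1, smul_comm]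
  have h5 := smul_right_injective Plane hY h4
  rw [div_eq_inv_mul, mul_smul, ← h5, inv_smul_smul₀ h3]

theorem HasDerivAt.wedge {f g : ℝ → Plane} {f' g' : Plane} {t : ℝ} (hf : HasDerivAt f f' t)
    (hg : HasDerivAt g g' t) :
    HasDerivAt (fun t => wedge (f t) (g t)) (wedge f' (g t) + wedge (f t) g') t := by
  have hf' (i : Fin 2) : HasDerivAt (fun t => f t i) (f' i) t :=
    (EuclideanSpace.proj (𝕜 := ℝ) i).hasFDerivAt.comp_hasDerivAt t hf
  have hg' (i : Fin 2) : HasDerivAt (fun t => g t i) (g' i) t :=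
    (EuclideanSpace.proj (𝕜 := ℝ) i).hasFDerivAt.comp_hasDerivAt t hg
  refine (((hf' 0).fun_mul (hg' 1)).fun_sub ((hf' 1).fun_mul (hg' 0))).congr_deriv ?_
  simp only [PlanarSewing.wedge]
  ring

theorem continuous_divergence {Z : Plane → Plane} (hZ : ContDiff ℝ ∞ Z) :
    Continuous (divergence Z) := by
  have := hZ.continuous_fderiv (by simp)
  unfold divergence
  fun_prop

/-! ### Vector fields with compact support and their flows -/

/-- Cutting off a smooth vector field away from a compact set. -/
theorem exists_compactSupport_eq_nhdsSet {M K : Set Plane} (hM : IsOpen M) (hK : IsCompact K)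
    (hKM : K ⊆ M) {Y : Plane → Plane} (hY : ContDiffOn ℝ ∞ Y M) :
    ∃ Z : Plane → Plane, ContDiff ℝ ∞ Z ∧ HasCompactSupport Z ∧ ∀ᶠ y in 𝓝ˢ K, Z y = Y y := by
  obtain ⟨K', hK', hKK', hK'M⟩ := exists_compact_between hK hM hKM
  obtain ⟨f, hf1, hf0, -⟩ := exists_contMDiffMap_one_nhds_of_subset_interior
    (modelWithCornersSelf ℝ Plane) (n := (⊤ : ℕ∞)) hK.isClosed hKK'
  have hf : ContDiff ℝ ∞ f := f.contMDiff.contDiff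
  have hz : ∀ x ∉ K', f x • Y x = 0 := fun x hx => by rw [hf0 x hx, zero_smul]
  refine ⟨fun x => f x • Y x, ?_, HasCompactSupport.intro hK' hz, ?_⟩
  · rw [contDiff_iff_contDiffAt]
    intro x
    by_cases hx : x ∈ M
    · exact hf.contDiffAt.smul (hY.contDiffAt (hM.mem_nhds hx))
    · refine (contDiffAt_const (c := (0 : Plane))).congr_of_eventuallyEq ?_
      filter_upwards [hK'.isClosed.isOpen_compl.mem_nhds fun h => hx (hK'M h)] with y hy
      exact hz y hy
  · filter_upwards [hf1] with y hy
    simp [hy]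

/-- A bounded Lipschitz vector field has a flow on every time interval. -/
theorem exists_flow {Z : Plane → Plane} (hZ : ContDiff ℝ ∞ Z) (hc : HasCompactSupport Z)
    {B : ℝ} (hB : 0 < B) :
    ∃ F : Plane → ℝ → Plane, ∀ q, F q 0 = q ∧
      ∀ t ∈ Ioo (-B) B, HasDerivAt (F q) (Z (F q t)) t := by
  obtain ⟨K, hK⟩ := hZ.lipschitzWith_of_hasCompactSupport hc (by simp)
  obtain ⟨C, hC⟩ := hc.exists_bound_of_continuous hZ.continuous
  have hC0 : 0 ≤ C := (norm_nonneg _).trans (hC 0)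
  have : ∀ q, ∃ α : ℝ → Plane, α 0 = q ∧ ∀ t ∈ Ioo (-B) B, HasDerivAt α (Z (α t)) t := by
    intro q
    have h0 : (0 : ℝ) ∈ Icc (-B) B := ⟨by linarith, hB.le⟩
    -- The radius `C * B` is the farthest a solution of speed at most `C` can travel in time `B`, so
    -- no shrinking of the time interval is necessary.
    have hPL : IsPicardLindelof (fun _ => Z) (⟨0, h0⟩ : Icc (-B) B) q
        (⟨C, hC0⟩ * ⟨B, hB.le⟩) 0 ⟨C, hC0⟩ K :=
      { lipschitzOnWith := fun t _ => hK.lipschitzOnWith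
        continuousOn := fun x _ => continuousOn_const
        norm_le := fun t _ x _ => hC x
        mul_max_le := by
          simp only [sub_zero, zero_sub, neg_neg, max_self, NNReal.coe_zero]
          exact le_rfl }
    obtain ⟨α, h1, h2⟩ := hPL.exists_eq_forall_mem_Icc_hasDerivWithinAt₀
    exact ⟨α, h1, fun t ht => (h2 t (Ioo_subset_Icc_self ht)).hasDerivAt
      (Icc_mem_nhds ht.1 ht.2)⟩
  choose F hF using this
  exact ⟨F, hF⟩

/-- A solution which is continuous up to its starting point solves the equation there. -/
theorem hasDerivWithinAt_zero_of_Ioo {Z : Plane → Plane} (hZ : Continuous Z) {c : ℝ → Plane}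
    {T : ℝ} (hT : 0 < T) (hc : ContinuousOn c (Icc 0 T))
    (hd : ∀ t ∈ Ioo 0 T, HasDerivAt c (Z (c t)) t) :
    HasDerivWithinAt c (Z (c 0)) (Ici 0) 0 := by
  have h0 : ContinuousWithinAt c (Icc 0 T) 0 := hc 0 (left_mem_Icc.2 hT.le)
  have hdiff : DifferentiableOn ℝ c (Ioo 0 T) := fun t ht =>
    (hd t ht).differentiableAt.differentiableWithinAt
  have h1 : Tendsto c (𝓝[>] 0) (𝓝 (c 0)) :=
    h0.mono_of_mem_nhdsWithin (Icc_mem_nhdsGT hT)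
  -- The arcs satisfy the equation only at interior times; at 0 the one-sided derivative is
  -- recovered as the limit of the derivatives.
  refine hasDerivWithinAt_Ici_of_tendsto_deriv hdiff (h0.mono Ioo_subset_Icc_self)
    (Ioo_mem_nhdsGT hT) ?_
  refine ((hZ.tendsto _).comp h1).congr' ?_
  filter_upwards [Ioo_mem_nhdsGT hT] with t ht
  exact (hd t ht).deriv.symm

/-- Uniqueness of solutions which are continuous up to their starting point. -/
theorem eqOn_of_solutions {Z : Plane → Plane} (hZ : ContDiff ℝ ∞ Z) (hs : HasCompactSupport Z)
    {b c : ℝ → Plane} {T : ℝ} (hT : 0 < T)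
    (hb : ContinuousOn b (Icc 0 T)) (hbd : ∀ t ∈ Ioo 0 T, HasDerivAt b (Z (b t)) t)
    (hc : ContinuousOn c (Icc 0 T)) (hcd : ∀ t ∈ Ioo 0 T, HasDerivAt c (Z (c t)) t)
    (h0 : b 0 = c 0) : EqOn b c (Icc 0 T) := by
  obtain ⟨K, hK⟩ := hZ.lipschitzWith_of_hasCompactSupport hs (by simp)
  have key : ∀ a : ℝ → Plane, ContinuousOn a (Icc 0 T) →
      (∀ t ∈ Ioo 0 T, HasDerivAt a (Z (a t)) t) →
      ∀ t ∈ Ico 0 T, HasDerivWithinAt a (Z (a t)) (Ici t) t := by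
    intro a ha had t ht
    rcases ht.1.eq_or_lt with rfl | h
    · exact hasDerivWithinAt_zero_of_Ioo hZ.continuous hT ha had
    · exact (had t ⟨h, ht.2⟩).hasDerivWithinAt
  exact ODE_solution_unique_of_mem_Icc_right (v := fun _ => Z) (s := fun _ => univ)
    (fun t _ => hK.lipschitzOnWith) hb (key b hb hbd) (fun _ _ => trivial)
    hc (key c hc hcd) (fun _ _ => trivial) h0

/-- Exponential bound for the separation of solutions. -/
theorem norm_sub_le_of_solutions {Z : Plane → Plane} {K : NNReal} (hK : LipschitzWith K Z)
    {b c : ℝ → Plane} {T : ℝ} (hb : ∀ t ∈ Icc 0 T, HasDerivAt b (Z (b t)) t)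
    (hc : ∀ t ∈ Icc 0 T, HasDerivAt c (Z (c t)) t) :
    ∀ t ∈ Icc 0 T, ‖c t - b t‖ ≤ Real.exp (K * T) * ‖c 0 - b 0‖ := by
  intro t ht
  have h := dist_le_of_trajectories_ODE (v := fun _ => Z) (fun _ => hK)
    (fun t ht => (hc t ht).continuousAt.continuousWithinAt)
    (fun t ht => (hc t (Ico_subset_Icc_self ht)).hasDerivWithinAt)
    (fun t ht => (hb t ht).continuousAt.continuousWithinAt)
    (fun t ht => (hb t (Ico_subset_Icc_self ht)).hasDerivWithinAt) le_rfl t ht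
  rw [dist_eq_norm, dist_eq_norm, mul_comm] at h
  refine h.trans ?_
  gcongr
  linarith [ht.2]

/-- Second order Taylor bound. -/
theorem exists_taylor_bound {Z : Plane → Plane} (hZ : ContDiff ℝ ∞ Z)
    (hs : HasCompactSupport Z) :
    ∃ C : ℝ, 0 ≤ C ∧ ∀ a b, ‖Z b - Z a - fderiv ℝ Z a (b - a)‖ ≤ C * ‖b - a‖ ^ 2 := by
  obtain ⟨C, hC⟩ := (hZ.fderiv_right (m := ∞) (by simp)).lipschitzWith_of_hasCompactSupport
    (hs.fderiv ℝ) (by simp)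
  refine ⟨C, C.2, fun a b => ?_⟩
  have h := (convex_segment a b).norm_image_sub_le_of_norm_hasFDerivWithin_le'
    (f := Z) (f' := fun x => fderiv ℝ Z x) (φ := fderiv ℝ Z a) (C := C * ‖b - a‖)
    (fun x _ => ((hZ.differentiable (by simp)) x).hasFDerivAt.hasFDerivWithinAt) (fun x hx => by
      rw [← dist_eq_norm]
      refine (hC.dist_le_mul x a).trans ?_
      gcongr
      rw [dist_eq_norm]
      obtain ⟨s, hs, rfl⟩ := (segment_eq_image' ℝ a b ▸ hx)
      simp only [add_sub_cancel_left, norm_smul, Real.norm_eq_abs, abs_of_nonneg hs.1]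
      exact mul_le_of_le_one_left (norm_nonneg _) hs.2)
    (left_mem_segment ℝ a b) (right_mem_segment ℝ a b)
  rw [pow_two, ← mul_assoc]
  exact h

/-- Liouville's formula for the area spanned by the field and the displacement of a solution, up
to second order in the initial displacement. -/
theorem exists_wedge_displacement_bound {Z : Plane → Plane} (hZ : ContDiff ℝ ∞ Z)
    (hs : HasCompactSupport Z) {a : ℝ → Plane} {T : ℝ} (hT : 0 ≤ T)
    (ha : ∀ t ∈ Icc 0 T, HasDerivAt a (Z (a t)) t) :
    ∃ C : ℝ, ∀ b : ℝ → Plane, (∀ t ∈ Icc 0 T, HasDerivAt b (Z (b t)) t) →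
      |wedge (Z (a T)) (b T - a T) -
        Real.exp (∫ t in (0 : ℝ)..T, divergence Z (a t)) * wedge (Z (a 0)) (b 0 - a 0)| ≤
      C * ‖b 0 - a 0‖ ^ 2 := by
  obtain ⟨K, hK⟩ := hZ.lipschitzWith_of_hasCompactSupport hs (by simp)
  obtain ⟨C₁, hC₁, hTay⟩ := exists_taylor_bound hZ hs
  obtain ⟨C₂, hC₂⟩ := hs.exists_bound_of_continuous hZ.continuous
  have hC₂0 : 0 ≤ C₂ := (norm_nonneg _).trans (hC₂ 0)
  have hac : ContinuousOn a (Icc 0 T) := fun t ht => (ha t ht).continuousAt.continuousWithinAt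
  -- a continuous extension of the divergence along the curve
  set d : ℝ → ℝ := IccExtend hT ((Icc 0 T).domRestrict fun t => divergence Z (a t)) with hd
  have hdc : Continuous d := by
    refine Continuous.Icc_extend' ?_
    exact continuousOn_iff_continuous_domRestrict.1 ((continuous_divergence hZ).comp_continuousOn hac)
  have hda : ∀ t ∈ Icc 0 T, d t = divergence Z (a t) := fun t ht => by
    rw [hd, IccExtend_of_mem _ _ ht]; rfl
  set D : ℝ → ℝ := fun t => ∫ s in (0 : ℝ)..t, d s with hD
  have hDd : ∀ t, HasDerivAt D (d t) t := fun t =>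
    intervalIntegral.integral_hasDerivAt_right (hdc.intervalIntegrable _ _)
      hdc.aestronglyMeasurable.stronglyMeasurableAtFilter hdc.continuousAt
  have hDc : Continuous D := continuous_iff_continuousAt.2 fun t => (hDd t).continuousAt
  obtain ⟨C₃, hC₃⟩ := isCompact_Icc.exists_bound_of_continuousOn (s := Icc 0 T)
    (f := fun t => Real.exp (-D t)) (by fun_prop)
  have hC₃0 : 0 ≤ C₃ := (norm_nonneg _).trans (hC₃ 0 ⟨le_rfl, hT⟩)
  have hDT : D T = ∫ t in (0 : ℝ)..T, divergence Z (a t) := by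
    refine intervalIntegral.integral_congr fun t ht => ?_
    rw [uIcc_of_le hT] at ht
    exact hda t ht
  rw [← hDT]
  set N := Real.exp (K * T) with hN
  -- `C₃` bounds the integrating factor, `C₂` the field, `C₁` the Taylor remainder and `N` the
  -- separation of orbits; `T` comes from the mean value inequality.
  refine ⟨Real.exp (D T) * (C₃ * (C₂ * (C₁ * N ^ 2)) * T), fun b hb => ?_⟩
  -- The integrating factor cancels the trace term of `wedge_trace`, so only the quadratic Taylor
  -- remainder is left in the derivative of `g`.
  set g : ℝ → ℝ := fun t => Real.exp (-D t) * wedge (Z (a t)) (b t - a t) with hg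
  have hsep := norm_sub_le_of_solutions hK ha hb
  have hgd : ∀ t ∈ Icc 0 T, HasDerivAt g (Real.exp (-D t) *
      wedge (Z (a t)) (Z (b t) - Z (a t) - fderiv ℝ Z (a t) (b t - a t))) t := by
    intro t ht
    have h1 : HasDerivAt (fun t => Z (a t)) (fderiv ℝ Z (a t) (Z (a t))) t :=
      ((hZ.differentiable (by simp)) (a t)).hasFDerivAt.comp_hasDerivAt t (ha t ht)
    have h2 := HasDerivAt.wedge h1 ((hb t ht).fun_sub (ha t ht))
    refine ((hDd t).fun_neg.exp.fun_mul h2).congr_deriv ?_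
    have h4 := wedge_trace (fderiv ℝ Z (a t)) (Z (a t)) (b t - a t)
    have h5 : wedge (Z (a t)) (Z (b t) - Z (a t) - fderiv ℝ Z (a t) (b t - a t)) =
        wedge (Z (a t)) (Z (b t) - Z (a t)) - wedge (Z (a t)) (fderiv ℝ Z (a t) (b t - a t)) := by
      simp only [← wedgeL_apply, map_sub]
    rw [h5, hda t ht]
    simp only [divergence]
    linear_combination (Real.exp (-D t)) * h4
  have hbound : ∀ t ∈ Ico 0 T, ‖Real.exp (-D t) *
      wedge (Z (a t)) (Z (b t) - Z (a t) - fderiv ℝ Z (a t) (b t - a t))‖ ≤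
      C₃ * (C₂ * (C₁ * N ^ 2)) * ‖b 0 - a 0‖ ^ 2 := by
    intro t ht
    have ht' := Ico_subset_Icc_self ht
    calc _ ≤ C₃ * (C₂ * (C₁ * (N * ‖b 0 - a 0‖) ^ 2)) := by
          rw [norm_mul]
          gcongr
          · exact hC₃ t ht'
          · refine (abs_wedge_le _ _).trans ?_
            gcongr
            · exact hC₂ _
            · refine (hTay _ _).trans ?_
              gcongr
              exact hsep t ht'
      _ = _ := by ring
  have h := norm_image_sub_le_of_norm_deriv_le_segment'
    (fun t ht => (hgd t ht).hasDerivWithinAt) hbound T (right_mem_Icc.2 hT)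
  have hD0 : D 0 = 0 := by simp [hD]
  have h6 : wedge (Z (a T)) (b T - a T) - Real.exp (D T) * wedge (Z (a 0)) (b 0 - a 0) =
      Real.exp (D T) * (g T - g 0) := by
    simp only [hg, hD0, neg_zero, Real.exp_zero, one_mul, mul_sub, ← mul_assoc, ← Real.exp_add,
      add_neg_cancel]
  rw [h6, abs_mul, Real.abs_exp]
  calc _ ≤ Real.exp (D T) *
        (C₃ * (C₂ * (C₁ * N ^ 2)) * ‖b 0 - a 0‖ ^ 2 * (T - 0)) := by
        gcongr
        exact h
    _ = _ := by ring

/-! ### Local geometry of the discontinuity locus -/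

theorem IsNormalCrossings.subset {M S : Set Plane} (hS : IsNormalCrossings M S) : S ⊆ M := by
  obtain ⟨N, C, hC, rfl⟩ := hS.components
  exact iUnion_subset fun j => (hC j).subset

theorem IsNormalCrossings.isOpen_diff {M S : Set Plane} (hM : IsOpen M)
    (hS : IsNormalCrossings M S) : IsOpen (M \ S) := by
  obtain ⟨N, C, hC, rfl⟩ := hS.components
  choose F hF hCF using fun j => (hC j).closed
  have : M \ ⋃ j, C j = M ∩ (⋃ j, F j)ᶜ := by
    ext x
    simp only [Set.mem_sdiff, mem_iUnion, mem_inter_iff, mem_compl_iff, hCF]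
    exact and_congr_right fun hx => not_congr (exists_congr fun i => and_iff_left hx)
  rw [this]
  exact hM.inter (isClosed_iUnion_of_finite hF).isOpen_compl

theorem IsComplementComponent.isOpen {M S W : Set Plane} (h : IsOpen (M \ S))
    (hW : IsComplementComponent M S W) : IsOpen W := by
  obtain ⟨x, -, rfl⟩ := hW
  exact h.connectedComponentIn

theorem IsComplementComponent.subset {M S W : Set Plane} (hW : IsComplementComponent M S W) :
    W ⊆ M \ S := by
  obtain ⟨x, -, rfl⟩ := hW
  exact connectedComponentIn_subset _ _

/-- Serves to place a whole orbit segment in one component, once it is known to avoid `S` and to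
meet that component at a single time. -/
theorem IsComplementComponent.subset_of_isPreconnected {M S W A : Set Plane}
    (hW : IsComplementComponent M S W) (hA : IsPreconnected A) (hAM : A ⊆ M \ S)
    (hne : (A ∩ W).Nonempty) : A ⊆ W := by
  obtain ⟨x, -, rfl⟩ := hW
  obtain ⟨y, hyA, hyW⟩ := hne
  rw [connectedComponentIn_eq hyW]
  exact hA.subset_connectedComponentIn hyA hAM

section Chart

variable {M S : Set Plane} {p : Plane} {φ : OpenPartialHomeomorph Plane Plane}

theorem IsLocalChart.contDiffAt (h : IsLocalChart M p φ) : ContDiffAt ℝ ∞ φ p :=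
  h.smooth.contDiffAt (φ.open_source.mem_nhds h.mem_source)

theorem IsLocalChart.hasFDerivAt (h : IsLocalChart M p φ) : HasFDerivAt φ (fderiv ℝ φ p) p :=
  (h.contDiffAt.differentiableAt (by simp)).hasFDerivAt

theorem IsLocalChart.hasFDerivAt_symm (h : IsLocalChart M p φ) :
    HasFDerivAt φ.symm (fderiv ℝ φ.symm 0) 0 := by
  have h0 : (0 : Plane) ∈ φ.target := h.center ▸ φ.map_source h.mem_source
  exact ((h.smooth_symm.contDiffAt (φ.open_target.mem_nhds h0)).differentiableAt
    (by simp)).hasFDerivAt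

theorem IsLocalChart.fderiv_symm_apply (h : IsLocalChart M p φ) (w : Plane) :
    fderiv ℝ φ.symm 0 (fderiv ℝ φ p w) = w := by
  have h1 : HasFDerivAt (fun x => φ.symm (φ x)) (fderiv ℝ φ.symm 0 ∘L fderiv ℝ φ p) p :=
    HasFDerivAt.comp p (h.center.symm ▸ h.hasFDerivAt_symm) h.hasFDerivAt
  have h2 : HasFDerivAt (fun x => φ.symm (φ x)) (ContinuousLinearMap.id ℝ Plane) p :=
    (hasFDerivAt_id p).congr_of_eventuallyEq (φ.eventually_left_inverse h.mem_source)
  have := congrArg (fun A : Plane →L[ℝ] Plane => A w) (h1.unique h2)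
  simpa using this

theorem IsAdaptedChart.mem_iff (h : IsAdaptedChart M S p 1 φ) {x : Plane} (hx : x ∈ φ.source) :
    x ∈ S ↔ φ x 0 = 0 := by
  rw [h.locus x hx, Fin.exists_fin_two]
  simp

theorem hasFDerivAt_plane_apply {f : Plane → Plane} {f' : Plane →L[ℝ] Plane} {x : Plane}
    (h : HasFDerivAt f f' x) (i : Fin 2) :
    HasFDerivAt (fun y => f y i) (EuclideanSpace.proj (𝕜 := ℝ) i ∘L f') x :=
  (EuclideanSpace.proj (𝕜 := ℝ) i).hasFDerivAt.comp x h

/-- A function vanishing along a curve has vanishing derivative in the direction of the curve. -/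
theorem apply_eq_zero_of_curve {h : Plane → ℝ} {ℓ : Plane →L[ℝ] ℝ} {z : ℝ → Plane} {v : Plane}
    {p : Plane} {t : ℝ} (hp : z t = p) (hh : HasFDerivAt h ℓ p) (hz : HasDerivAt z v t) (h0 : ∀ᶠ s in 𝓝 t, h (z s) = 0) :
    ℓ v = 0 := by
  subst hp
  have h1 : HasDerivAt (fun s => h (z s)) (ℓ v) t := hh.comp_hasDerivAt t hz
  exact h1.unique ((hasDerivAt_const t (0 : ℝ)).congr_of_eventuallyEq h0)

/-- A tangent vector is the velocity of a curve in the locus. -/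
theorem IsTangentAt.exists_curve {w : Plane} (hw : IsTangentAt M S p w) :
    ∃ z : ℝ → Plane, z 0 = p ∧ HasDerivAt z w 0 ∧ ∀ᶠ s in 𝓝 0, z s ∈ S := by
  obtain ⟨φ, hφ, hw0⟩ := hw
  have hc : HasDerivAt (fun s : ℝ => s • fderiv ℝ φ p w) (fderiv ℝ φ p w) 0 := by
    simpa using (hasDerivAt_id (0 : ℝ)).smul_const (fderiv ℝ φ p w)
  have h0 : (0 : Plane) ∈ φ.target := hφ.center ▸ φ.map_source hφ.mem_source
  -- In the chart the line spanned by the image of `w` lies in the locus. Tangency and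
  -- transversality may be witnessed by different charts; curves in `S` make them comparable.
  refine ⟨fun s => φ.symm (s • fderiv ℝ φ p w), ?_, ?_, ?_⟩
  · simp only [zero_smul]
    rw [← hφ.center, φ.left_inv hφ.mem_source]
  · have := HasFDerivAt.comp_hasDerivAt_of_eq (f := fun s : ℝ => s • fderiv ℝ φ p w) 0
      hφ.hasFDerivAt_symm hc (zero_smul ℝ _).symm
    rwa [hφ.fderiv_symm_apply] at this
  · have : ∀ᶠ s : ℝ in 𝓝 0, s • fderiv ℝ φ p w ∈ φ.target := by
      refine hc.continuousAt.eventually ?_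
      simp only [zero_smul]
      exact φ.open_target.mem_nhds h0
    filter_upwards [this] with s hs
    rw [hφ.mem_iff (φ.map_target hs), φ.right_inv hs]
    simp [hw0]

/-- Near a point where `v` is transverse to `S`, the locus is the zero set of a function growing
in the direction `v`. -/
theorem IsTransverseAt.exists_defining {v : Plane} (h : IsTransverseAt M S p v) :
    ∃ (U : Set Plane) (f : Plane → ℝ), IsOpen U ∧ p ∈ U ∧ U ⊆ M ∧ ContDiffOn ℝ 1 f U ∧
      f p = 0 ∧ (∀ x ∈ U, x ∈ S ↔ f x = 0) ∧ 0 < fderiv ℝ f p v ∧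
      ∀ z : ℝ → Plane, ∀ w, z 0 = p → HasDerivAt z w 0 → (∀ᶠ s in 𝓝 0, z s ∈ S) →
        fderiv ℝ f p w = 0 := by
  obtain ⟨φ, hφ, hv⟩ := h
  -- Scaling the first coordinate by `c` makes its derivative along `v` equal to c² > 0, whichever
  -- side `v` points to.
  set c : ℝ := (fderiv ℝ φ p v) 0 with hc
  have hd : HasFDerivAt (fun x => c * φ x 0)
      (c • (EuclideanSpace.proj (𝕜 := ℝ) (0 : Fin 2) ∘L fderiv ℝ φ p)) p :=
    (hasFDerivAt_plane_apply hφ.hasFDerivAt 0).const_mul c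
  have hU : ∀ x ∈ φ.source, x ∈ S ↔ c * φ x 0 = 0 := fun x hx => by
    rw [hφ.mem_iff hx, mul_eq_zero, or_iff_right hv]
  refine ⟨φ.source, fun x => c * φ x 0, φ.open_source, hφ.mem_source, hφ.source_subset, ?_,
    by simp [hφ.center], hU, ?_, ?_⟩
  · exact contDiffOn_const.mul ((contDiffOn_euclidean.1 hφ.smooth 0).of_le (by simp))
  · rw [hd.fderiv]
    exact mul_self_pos.2 hv
  · intro z w hz0 hz hzS
    rw [hd.fderiv]
    refine apply_eq_zero_of_curve hz0 hd hz ?_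
    have : ∀ᶠ s in 𝓝 0, z s ∈ φ.source :=
      hz.continuousAt.eventually (hz0 ▸ φ.open_source.mem_nhds hφ.mem_source)
    filter_upwards [this, hzS] with s hs hs'
    exact (hU _ hs).1 hs'

/-- A regular parametrization of a piece of `S` has a differentiable local inverse. -/
theorem IsAdaptedChart.exists_section_inverse (hφ : IsAdaptedChart M S p 1 φ) {σ : ℝ → Plane}
    {δ : ℝ} (hδ : 0 < δ) (hσ : ContDiffOn ℝ ∞ σ (Ioo (-δ) δ)) (hσ' : deriv σ 0 ≠ 0)
    (hσS : MapsTo σ (Ioo (-δ) δ) S) (hσ0 : σ 0 = p) :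
    ∃ ρ : Plane → ℝ, DifferentiableAt ℝ ρ p ∧
      (∀ᶠ q in 𝓝 p, q ∈ S → ρ q ∈ Ioo (-δ) δ ∧ σ (ρ q) = q) ∧ ∀ᶠ x in 𝓝 0, ρ (σ x) = x := by
  have hI : Ioo (-δ) δ ∈ 𝓝 (0 : ℝ) := Ioo_mem_nhds (by linarith) hδ
  have hσa : ContDiffAt ℝ ∞ σ 0 := hσ.contDiffAt hI
  have hσd : HasDerivAt σ (deriv σ 0) 0 := (hσa.differentiableAt (by simp)).hasDerivAt
  have hsrc : ∀ᶠ x in 𝓝 0, σ x ∈ φ.source :=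
    hσd.continuousAt.eventually (hσ0 ▸ φ.open_source.mem_nhds hφ.mem_source)
  have hφσ : HasFDerivAt φ (fderiv ℝ φ p) (σ 0) := hσ0 ▸ hφ.hasFDerivAt
  set f : ℝ → ℝ := fun x => φ (σ x) 1 with hf
  have hfc : ContDiffAt ℝ ∞ f 0 :=
    contDiffAt_euclidean.1 (ContDiffAt.comp 0 (hσ0 ▸ hφ.contDiffAt) hσa) 1
  have hfd : HasDerivAt f ((fderiv ℝ φ p (deriv σ 0)) 1) 0 :=
    (hasFDerivAt_plane_apply hφσ 1).comp_hasDerivAt 0 hσd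
  have h0 : (fderiv ℝ φ p (deriv σ 0)) 0 = 0 := by
    refine apply_eq_zero_of_curve rfl (hasFDerivAt_plane_apply hφσ 0) hσd ?_
    filter_upwards [hsrc, hI] with x hx hxI
    exact (hφ.mem_iff hx).1 (hσS hxI)
  -- The velocity of `σ` has no first coordinate, since `σ` runs in `S`; regularity then forces the
  -- second to be non-zero.
  have hf' : (fderiv ℝ φ p (deriv σ 0)) 1 ≠ 0 := by
    intro h1
    apply hσ'
    rw [← hφ.fderiv_symm_apply (deriv σ 0)]
    have : fderiv ℝ φ p (deriv σ 0) = 0 := by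
      ext j
      fin_cases j
      · exact h0
      · exact h1
    rw [this, map_zero]
  have hfs : HasStrictDerivAt f ((fderiv ℝ φ p (deriv σ 0)) 1) 0 := by
    have := hfc.hasStrictDerivAt (by simp)
    rwa [hfd.deriv] at this
  have hf0 : f 0 = 0 := by simp [hf, hσ0, hφ.center]
  set g : ℝ → ℝ := hfs.localInverse f _ 0 hf' with hg
  have hleft : ∀ᶠ x in 𝓝 0, g (f x) = x := hfs.eventually_left_inverse hf'
  have hgd : HasStrictDerivAt g ((fderiv ℝ φ p (deriv σ 0)) 1)⁻¹ (f 0) :=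
    hfs.to_localInverse hf'
  have hg0 : g (f 0) = 0 := hleft.self_of_nhds
  have hright : ∀ᶠ y in 𝓝 (f 0), f (g y) = y := hfs.eventually_right_inverse hf'
  have hφ1 : HasFDerivAt (fun q => φ q 1) _ p := hasFDerivAt_plane_apply hφ.hasFDerivAt 1
  have hp1 : φ p 1 = f 0 := by simp only [hf, hσ0]
  have hρ : DifferentiableAt ℝ (fun q => g (φ q 1)) p := by
    refine DifferentiableAt.comp (g := g) p ?_ hφ1.differentiableAt
    rw [hp1]
    exact hgd.hasDerivAt.differentiableAt
  have hρ0 : g (φ p 1) = 0 := by rw [hp1, hg0]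
  -- On `S` the first coordinate is zero, so the second one determines the point: inverting `x ↦ φ
  -- (σ x) 1` recovers the parameter.
  refine ⟨fun q => g (φ q 1), hρ, ?_, hleft⟩
  have ht : Tendsto (fun q => g (φ q 1)) (𝓝 p) (𝓝 0) := by
    have := hρ.continuousAt.tendsto
    rwa [hρ0] at this
  have ht1 : Tendsto (fun q => φ q 1) (𝓝 p) (𝓝 (f 0)) := by
    rw [← hp1]
    exact hφ1.continuousAt.tendsto
  filter_upwards [ht.eventually hI, ht.eventually hsrc, ht1.eventually hright,
    φ.open_source.mem_nhds hφ.mem_source] with q h1 h2 h3 h4 hqS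
  refine ⟨h1, φ.injOn h2 h4 ?_⟩
  ext j
  fin_cases j
  · exact ((hφ.mem_iff h2).1 (hσS h1)).trans ((hφ.mem_iff h4).1 hqS).symm
  · exact h3

end Chart

/-! ### Crossing a transverse section -/

/-- `F` is a flow of the vector field `Z` for times in `(-B, B)`. -/
structure IsFlow (Z : Plane → Plane) (B : ℝ) (F : Plane → ℝ → Plane) : Prop where
  zero : ∀ q, F q 0 = q
  deriv : ∀ q, ∀ t ∈ Ioo (-B) B, HasDerivAt (F q) (Z (F q t)) t

section Flow

variable {Z : Plane → Plane} {B : ℝ} {F : Plane → ℝ → Plane} {p : Plane}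

theorem IsFlow.continuousOn (hF : IsFlow Z B F) (q : Plane) : ContinuousOn (F q) (Ioo (-B) B) :=
  fun t ht => (hF.deriv q t ht).continuousAt.continuousWithinAt

theorem IsFlow.norm_sub_le (hF : IsFlow Z B F) {K : NNReal} (hK : LipschitzWith K Z)
    {T : ℝ} (hT : T < B) (p q : Plane) :
    ∀ t ∈ Icc 0 T, ‖F q t - F p t‖ ≤ Real.exp (K * T) * ‖q - p‖ := by
  intro t ht
  have hI : ∀ t ∈ Icc 0 T, t ∈ Ioo (-B) B := fun t ht =>
    ⟨by linarith [ht.1, ht.2], by linarith [ht.2]⟩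
  have := norm_sub_le_of_solutions hK (fun t ht => hF.deriv p t (hI t ht))
    (fun t ht => hF.deriv q t (hI t ht)) t ht
  rwa [hF.zero, hF.zero] at this

/-- Joint continuity follows from the Grönwall comparison with the orbit of `p`. That estimate runs
forward from time 0, hence the restriction to `Ici 0`. -/
theorem IsFlow.tendsto (hF : IsFlow Z B F) {K : NNReal} (hK : LipschitzWith K Z)
    {T : ℝ} (hT0 : 0 ≤ T) (hT : T < B) :
    Tendsto (fun x : Plane × ℝ => F x.1 x.2) (𝓝 p ×ˢ 𝓝[Ici 0] T) (𝓝 (F p T)) := by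
  have h1 : Tendsto (fun x : Plane × ℝ => F p x.2) (𝓝 p ×ˢ 𝓝[Ici 0] T) (𝓝 (F p T)) :=
    ((hF.deriv p T ⟨by linarith, hT⟩).continuousAt.tendsto.mono_left
      nhdsWithin_le_nhds).comp tendsto_snd
  have h2 : Tendsto (fun x : Plane × ℝ => F x.1 x.2 - F p x.2) (𝓝 p ×ˢ 𝓝[Ici 0] T) (𝓝 0) := by
    have hlim : Tendsto (fun x : Plane × ℝ => Real.exp (K * ((T + B) / 2)) * ‖x.1 - p‖)
        (𝓝 p ×ˢ 𝓝[Ici 0] T) (𝓝 0) := by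
      have : Tendsto (fun q : Plane => Real.exp (K * ((T + B) / 2)) * ‖q - p‖) (𝓝 p) (𝓝 0) := by
        have hc : Continuous fun q : Plane => Real.exp (K * ((T + B) / 2)) * ‖q - p‖ := by
          fun_prop
        simpa using hc.tendsto p
      exact this.comp tendsto_fst
    refine squeeze_zero_norm' ?_ hlim
    have ht : ∀ᶠ t in 𝓝[Ici 0] T, t ∈ Icc 0 ((T + B) / 2) := by
      filter_upwards [self_mem_nhdsWithin,
        mem_nhdsWithin_of_mem_nhds (Iic_mem_nhds (show T < (T + B) / 2 by linarith))]
        with t h1 h2 using ⟨h1, h2⟩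
    filter_upwards [ht.prod_inr (𝓝 p)] with x hx
    exact hF.norm_sub_le hK (by linarith) p x.1 x.2 hx
  simpa using h2.add h1

/-- Nearby orbits stay in a neighbourhood of a compact piece of orbit. -/
theorem IsFlow.eventually_mem (hF : IsFlow Z B F) {K : NNReal} (hK : LipschitzWith K Z)
    {a b : ℝ} (ha : 0 ≤ a) (hb : b < B) {O : Set Plane} (hO : IsOpen O)
    (h : ∀ t ∈ Icc a b, F p t ∈ O) : ∀ᶠ q in 𝓝 p, ∀ t ∈ Icc a b, F q t ∈ O := by
  rcases lt_or_ge b a with hab | hab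
  · exact Eventually.of_forall fun q t ht => absurd (ht.1.trans ht.2) hab.not_ge
  have hc : IsCompact (F p '' Icc a b) := isCompact_Icc.image_of_continuousOn
    ((hF.continuousOn p).mono fun t ht => ⟨by linarith [ht.1], by linarith [ht.2]⟩)
  obtain ⟨r, hr, hrO⟩ := hc.exists_thickening_subset_open hO (image_subset_iff.2 h)
  have hlim : Tendsto (fun q : Plane => Real.exp (K * b) * ‖q - p‖) (𝓝 p) (𝓝 0) := by
    have hc : Continuous fun q : Plane => Real.exp (K * b) * ‖q - p‖ := by fun_prop
    simpa using hc.tendsto p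
  filter_upwards [hlim.eventually (gt_mem_nhds hr)] with q hq t ht
  refine hrO (mem_thickening_iff.2 ⟨F p t, mem_image_of_mem _ ht, ?_⟩)
  rw [dist_eq_norm]
  exact (hF.norm_sub_le hK hb p q t ⟨ha.trans ht.1, ht.2⟩).trans_lt hq

/-- A function whose derivative along the field is positive at a point of an orbit grows
uniformly along the nearby orbits. -/
theorem IsFlow.exists_growth (hF : IsFlow Z B F) {K : NNReal} (hK : LipschitzWith K Z)
    {T : ℝ} (hT0 : 0 ≤ T) (hT : T < B) {U : Set Plane} (hU : IsOpen U) {f : Plane → ℝ}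
    (hf : ContDiffOn ℝ 1 f U) (hTU : F p T ∈ U) (hpos : 0 < fderiv ℝ f (F p T) (Z (F p T))) :
    ∃ η > 0, T + η < B ∧ ∃ κ > 0, ∀ᶠ q in 𝓝 p,
      (∀ t ∈ Icc (T - η) (T + η), 0 ≤ t → F q t ∈ U) ∧
      ∀ s ∈ Icc (T - η) (T + η), 0 ≤ s → ∀ t ∈ Icc (T - η) (T + η), s ≤ t →
        κ * (t - s) ≤ f (F q t) - f (F q s) := by
  -- Half the derivative at the base point remains a lower bound nearby. Requiring times to be
  -- non-negative allows `T = 0`, for leaving the locus, as well as `T > 0`, for landing on it.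
  set κ := fderiv ℝ f (F p T) (Z (F p T)) / 2 with hκ
  have hcont : ContinuousAt (fun x => fderiv ℝ f x (Z x)) (F p T) :=
    ((hf.continuousOn_fderiv_of_isOpen hU le_rfl).continuousAt (hU.mem_nhds hTU)).clm_apply
      hK.continuous.continuousAt
  have hev : ∀ᶠ x in 𝓝 (F p T), x ∈ U ∧ κ ≤ fderiv ℝ f x (Z x) :=
    (hU.eventually_mem hTU).and (hcont.eventually (le_mem_nhds (by linarith)))
  obtain ⟨pa, hpa, pb, hpb, hab⟩ := eventually_prod_iff.1 ((hF.tendsto hK hT0 hT).eventually hev)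
  obtain ⟨ε, hε, hεb⟩ := Metric.mem_nhdsWithin_iff.1 hpb
  refine ⟨min (ε / 2) ((B - T) / 2), lt_min (by linarith) (by linarith), ?_, κ, by linarith, ?_⟩
  · linarith [min_le_right (ε / 2) ((B - T) / 2)]
  set η := min (ε / 2) ((B - T) / 2) with hη
  have hη1 : η ≤ ε / 2 := min_le_left _ _
  have hη2 : η ≤ (B - T) / 2 := min_le_right _ _
  filter_upwards [hpa] with q hq
  have hgood : ∀ t ∈ Icc (T - η) (T + η), 0 ≤ t →
      F q t ∈ U ∧ κ ≤ fderiv ℝ f (F q t) (Z (F q t)) := by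
    intro t ht ht0
    refine hab hq (hεb ⟨?_, ht0⟩)
    rw [mem_ball, Real.dist_eq, abs_lt]
    constructor <;> linarith [ht.1, ht.2]
  refine ⟨fun t ht ht0 => (hgood t ht ht0).1, fun s hs hs0 t ht hst => ?_⟩
  have hmem : ∀ r ∈ Icc s t, r ∈ Icc (T - η) (T + η) ∧ 0 ≤ r := fun r hr =>
    ⟨⟨hs.1.trans hr.1, hr.2.trans ht.2⟩, hs0.trans hr.1⟩
  have hd : ∀ r ∈ Icc s t,
      HasDerivAt (fun r => f (F q r)) (fderiv ℝ f (F q r) (Z (F q r))) r := by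
    intro r hr
    obtain ⟨h1, h2⟩ := hmem r hr
    have h3 : DifferentiableAt ℝ f (F q r) :=
      (hf.contDiffAt (hU.mem_nhds (hgood r h1 h2).1)).differentiableAt (by simp)
    exact h3.hasFDerivAt.comp_hasDerivAt r (hF.deriv q r ⟨by linarith, by linarith [h1.2]⟩)
  refine (convex_Icc s t).mul_sub_le_image_sub_of_le_deriv
    (fun r hr => (hd r hr).continuousAt.continuousWithinAt)
    (fun r hr => (hd r (interior_subset hr)).differentiableAt.differentiableWithinAt)
    (fun r hr => ?_) s (left_mem_Icc.2 hst) t (right_mem_Icc.2 hst) hst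
  have hr' := interior_subset hr
  rw [(hd r hr').deriv]
  exact (hgood r (hmem r hr').1 (hmem r hr').2).2

/-- The displacement along an orbit is close to linear. -/
theorem IsFlow.norm_sub_sub_smul_le (hF : IsFlow Z B F) {K : NNReal} (hK : LipschitzWith K Z)
    {C : ℝ} (hC : ∀ x, ‖Z x‖ ≤ C) {T s : ℝ} (hT : T ∈ Ioo (-B) B) (hs : s ∈ Ioo (-B) B)
    (q y : Plane) :
    ‖F q s - F q T - (s - T) • Z y‖ ≤ K * (C * |s - T| + ‖F q T - y‖) * |s - T| := by
  have hI : uIcc T s ⊆ Ioo (-B) B := ordConnected_Ioo.uIcc_subset hT hs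
  have h1 : ∀ t ∈ uIcc T s, ‖F q t - F q T‖ ≤ C * |s - T| := by
    intro t ht
    have h := (convex_uIcc T s).norm_image_sub_le_of_norm_hasDerivWithin_le
      (fun r hr => (hF.deriv q r (hI hr)).hasDerivWithinAt) (fun r _ => hC _) left_mem_uIcc ht
    refine h.trans ?_
    have := (norm_nonneg _).trans (hC 0)
    gcongr
    rw [Real.norm_eq_abs]
    exact abs_sub_left_of_mem_uIcc ht
  -- Mean value inequality for the orbit minus the straight motion `t • Z y`, whose derivative is
  -- small by the Lipschitz bound and `h1`.
  have h2 := (convex_uIcc T s).norm_image_sub_le_of_norm_hasDerivWithin_le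
    (f := fun t => F q t - t • Z y) (f' := fun t => Z (F q t) - (1 : ℝ) • Z y)
    (C := K * (C * |s - T| + ‖F q T - y‖))
    (fun r hr => ((hF.deriv q r (hI hr)).sub
      ((hasDerivAt_id r).smul_const (Z y))).hasDerivWithinAt)
    (fun r hr => by
      rw [one_smul, ← dist_eq_norm]
      refine (hK.dist_le_mul _ _).trans ?_
      gcongr
      rw [dist_eq_norm, ← sub_add_sub_cancel _ (F q T)]
      exact (norm_add_le _ _).trans (by gcongr; exact h1 r hr))
    left_mem_uIcc right_mem_uIcc
  have h3 : F q s - s • Z y - (F q T - T • Z y) = F q s - F q T - (s - T) • Z y := by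
    rw [sub_smul]; abel
  rwa [h3, Real.norm_eq_abs] at h2

/-- The landing map on a transverse section: existence, location and derivative. -/
theorem IsFlow.exists_landing (hF : IsFlow Z B F) (hZ : ContDiff ℝ ∞ Z) (hs : HasCompactSupport Z)
    {T : ℝ} (hT0 : 0 < T) (hT : T < B) {U : Set Plane} (hU : IsOpen U) {f : Plane → ℝ}
    (hf : ContDiffOn ℝ 1 f U) (hTU : F p T ∈ U) (hfT : f (F p T) = 0)
    (hpos : 0 < fderiv ℝ f (F p T) (Z (F p T))) :
    ∃ s : Plane → ℝ, s p = T ∧ Tendsto s (𝓝 p) (𝓝 T) ∧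
      (∀ᶠ q in 𝓝 p, F q (s q) ∈ U ∧ f (F q (s q)) = 0) ∧
      (∃ η > 0, ∀ᶠ q in 𝓝 p, ∀ t ∈ Ico (T - η) (s q), F q t ∈ U ∧ f (F q t) < 0) ∧
      HasFDerivAt (fun q => F q (s q))
        ((fderiv ℝ f (F p T) (Z (F p T)))⁻¹ •
          (Real.exp (∫ t in (0 : ℝ)..T, divergence Z (F p t)) •
            wedgeL (Z p)).smulRight (kerVec (fderiv ℝ f (F p T)))) p := by
  obtain ⟨K, hK⟩ := hZ.lipschitzWith_of_hasCompactSupport hs (by simp)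
  obtain ⟨C, hC⟩ := hs.exists_bound_of_continuous hZ.continuous
  have hC0 : 0 ≤ C := (norm_nonneg _).trans (hC 0)
  obtain ⟨η₀, hη₀, hη₀B, κ, hκ, hgrow₀⟩ := hF.exists_growth hK hT0.le hT hU hf hTU hpos
  set η := min η₀ (T / 2) with hη
  have hη0 : 0 < η := lt_min hη₀ (by linarith)
  have hη1 : η ≤ η₀ := min_le_left _ _
  have hη2 : η ≤ T / 2 := min_le_right _ _
  have hpos' : ∀ t ∈ Icc (T - η) (T + η), 0 ≤ t := fun t ht => by linarith [ht.1]
  have hIB : ∀ t ∈ Icc (T - η) (T + η), t ∈ Ioo (-B) B := fun t ht =>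
    ⟨by linarith [ht.1], by linarith [ht.2]⟩
  have hTI : T ∈ Icc (T - η) (T + η) := ⟨by linarith, by linarith⟩
  have hgrow : ∀ᶠ q in 𝓝 p, (∀ t ∈ Icc (T - η) (T + η), F q t ∈ U) ∧
      ∀ s ∈ Icc (T - η) (T + η), ∀ t ∈ Icc (T - η) (T + η), s ≤ t →
        κ * (t - s) ≤ f (F q t) - f (F q s) := by
    have hsub : Icc (T - η) (T + η) ⊆ Icc (T - η₀) (T + η₀) :=
      Icc_subset_Icc (by linarith) (by linarith)
    filter_upwards [hgrow₀] with q hq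
    exact ⟨fun t ht => hq.1 t (hsub ht) (hpos' t ht), fun s hs t ht hst =>
      hq.2 s (hsub hs) (hpos' s hs) t (hsub ht) hst⟩
  have hgp := hgrow.self_of_nhds
  -- sign of `f` at both ends of the time window
  have hfF : ∀ t ∈ Icc (T - η) (T + η), ContinuousAt (fun q => f (F q t)) p := by
    intro t ht
    have h1 : ContinuousAt (fun q => F q t) p := by
      have h := hF.tendsto (p := p) hK (hpos' t ht) (hIB t ht).2
      have h2 : Tendsto (fun q => (q, t)) (𝓝 p) (𝓝 p ×ˢ 𝓝[Ici 0] t) :=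
        tendsto_id.prodMk (tendsto_nhdsWithin_iff.2
          ⟨tendsto_const_nhds, Eventually.of_forall fun _ => hpos' t ht⟩)
      exact h.comp h2
    exact ContinuousAt.comp (g := f) (hf.continuousOn.continuousAt (hU.mem_nhds (hgp.1 t ht))) h1
  have hlI : T - η ∈ Icc (T - η) (T + η) := ⟨le_rfl, by linarith⟩
  have hrI : T + η ∈ Icc (T - η) (T + η) := ⟨by linarith, le_rfl⟩
  have hneg : ∀ᶠ q in 𝓝 p, f (F q (T - η)) < 0 := by
    refine (hfF _ hlI).eventually (gt_mem_nhds ?_)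
    have := hgp.2 _ hlI T hTI (by linarith)
    have h2 : 0 < κ * (T - (T - η)) := by rw [sub_sub_cancel]; positivity
    linarith
  have hpos2 : ∀ᶠ q in 𝓝 p, 0 < f (F q (T + η)) := by
    refine (hfF _ hrI).eventually (lt_mem_nhds ?_)
    have := hgp.2 T hTI _ hrI (by linarith)
    have h2 : 0 < κ * (T + η - T) := by rw [add_sub_cancel_left]; positivity
    linarith
  -- The sign change gives a zero for `q` near `p`; other points get the irrelevant time 0, which
  -- makes the landing time a total function.
  have hex : ∀ q, ∃ t, ((∀ t ∈ Icc (T - η) (T + η), F q t ∈ U) ∧ f (F q (T - η)) < 0 ∧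
      0 < f (F q (T + η))) → t ∈ Icc (T - η) (T + η) ∧ f (F q t) = 0 := by
    intro q
    by_cases h : (∀ t ∈ Icc (T - η) (T + η), F q t ∈ U) ∧ f (F q (T - η)) < 0 ∧
      0 < f (F q (T + η))
    · have hc : ContinuousOn (fun t => f (F q t)) (Icc (T - η) (T + η)) :=
        hf.continuousOn.comp ((hF.continuousOn q).mono hIB) h.1
      obtain ⟨t, ht, ht0⟩ := intermediate_value_Icc (by linarith) hc ⟨h.2.1.le, h.2.2.le⟩
      exact ⟨t, fun _ => ⟨ht, ht0⟩⟩
    · exact ⟨0, fun h' => absurd h' h⟩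
  choose s hs0 using hex
  have hgood : ∀ᶠ q in 𝓝 p, ((∀ t ∈ Icc (T - η) (T + η), F q t ∈ U) ∧
      ∀ s ∈ Icc (T - η) (T + η), ∀ t ∈ Icc (T - η) (T + η), s ≤ t →
        κ * (t - s) ≤ f (F q t) - f (F q s)) ∧ s q ∈ Icc (T - η) (T + η) ∧ f (F q (s q)) = 0 := by
    filter_upwards [hgrow, hneg, hpos2] with q h1 h2 h3
    exact ⟨h1, hs0 q ⟨h1.1, h2, h3⟩⟩
  -- Uniform growth of `f` between the times `T` and `s q`. This yields both `s p = T` and the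
  -- estimate of `s q - T` by a multiple of `‖q - p‖`.
  have hsT : ∀ᶠ q in 𝓝 p, κ * |s q - T| ≤ |f (F q T)| := by
    filter_upwards [hgood] with q ⟨h1, h2, h3⟩
    rcases le_total (s q) T with h | h
    · have := h1.2 _ h2 _ hTI h
      rw [abs_of_nonpos (by linarith)]
      linarith [le_abs_self (f (F q T))]
    · have := h1.2 _ hTI _ h2 h
      rw [abs_of_nonneg (by linarith)]
      linarith [neg_le_abs (f (F q T))]
  have hsp : s p = T := by
    have := hsT.self_of_nhds
    rw [hfT, abs_zero] at this
    have h2 : |s p - T| ≤ 0 := by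
      by_contra! h
      linarith [mul_pos hκ h]
    linarith [abs_nonpos_iff.1 h2]
  have hsub0 : Tendsto (fun q => q - p) (𝓝 p) (𝓝 0) :=
    tendsto_sub_nhds_zero_iff.2 tendsto_id
  set N := Real.exp (K * T) with hN
  have hFT : ∀ q, ‖F q T - F p T‖ ≤ N * ‖q - p‖ := fun q =>
    hF.norm_sub_le hK hT p q T ⟨hT0.le, le_rfl⟩
  have hFTO : (fun q => F q T - F p T) =O[𝓝 p] fun q => q - p :=
    IsBigO.of_bound N (Eventually.of_forall hFT)
  have hFTc : Tendsto (fun q => F q T) (𝓝 p) (𝓝 (F p T)) := by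
    simpa using (hFTO.trans_tendsto hsub0).add_const (F p T)
  have hfd : HasFDerivAt f (fderiv ℝ f (F p T)) (F p T) :=
    ((hf.contDiffAt (hU.mem_nhds hTU)).differentiableAt (by simp)).hasFDerivAt
  set ℓ := fderiv ℝ f (F p T) with hℓ
  have hsO : (fun q => s q - T) =O[𝓝 p] fun q => q - p := by
    have h1 : (fun q => f (F q T)) =O[𝓝 p] fun q => q - p := by
      have := (hfd.isBigO_sub.comp_tendsto hFTc).trans hFTO
      simpa [Function.comp_def, hfT] using this
    refine IsBigO.trans (IsBigO.of_bound κ⁻¹ ?_) h1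
    filter_upwards [hsT] with q hq
    rw [Real.norm_eq_abs, Real.norm_eq_abs, inv_mul_eq_div, le_div_iff₀ hκ]
    linarith
  have hst : Tendsto s (𝓝 p) (𝓝 T) := by
    simpa using (hsO.trans_tendsto hsub0).add_const T
  refine ⟨s, hsp, hst, ?_, ⟨η, hη0, ?_⟩, ?_⟩
  · filter_upwards [hgood] with q ⟨h1, h2, h3⟩
    exact ⟨h1.1 _ h2, h3⟩
  · filter_upwards [hgood] with q ⟨h1, h2, h3⟩ t ht
    have ht' : t ∈ Icc (T - η) (T + η) := ⟨ht.1, ht.2.le.trans h2.2⟩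
    refine ⟨h1.1 t ht', ?_⟩
    have := h1.2 t ht' _ h2 ht.2.le
    linarith [mul_pos hκ (sub_pos.2 ht.2)]
  -- the derivative of the landing map
  set Y := Z (F p T) with hY
  set P : Plane → Plane := fun q => F q (s q) with hP
  have hPp : P p = F p T := by simp only [hP, hsp]
  have hrem : (fun q => P q - F q T - (s q - T) • Y) =O[𝓝 p] fun q => ‖q - p‖ ^ 2 := by
    obtain ⟨c, hc⟩ := hsO.bound
    refine IsBigO.of_bound (K * (C * |c| + N) * |c|) ?_
    filter_upwards [hgood, hc] with q ⟨_, h2, _⟩ hq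
    have hq' : |s q - T| ≤ |c| * ‖q - p‖ := hq.trans (by gcongr; exact le_abs_self c)
    calc _ ≤ K * (C * |s q - T| + ‖F q T - F p T‖) * |s q - T| :=
          hF.norm_sub_sub_smul_le hK hC (hIB T hTI) (hIB _ h2) q (F p T)
      _ ≤ K * (C * (|c| * ‖q - p‖) + N * ‖q - p‖) * (|c| * ‖q - p‖) := by
          gcongr
          exact hFT q
      _ = _ := by rw [norm_pow, norm_norm]; ring
  have hPO : (fun q => P q - F p T) =O[𝓝 p] fun q => q - p := by
    have h1 : (fun q => P q - F q T - (s q - T) • Y) =O[𝓝 p] fun q => q - p :=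
      hrem.trans (isLittleO_pow_sub_sub p one_lt_two).isBigO
    have h2 : (fun q => (s q - T) • Y) =O[𝓝 p] fun q => q - p := by
      refine IsBigO.trans (IsBigO.of_bound ‖Y‖ (Eventually.of_forall fun q => ?_)) hsO
      rw [norm_smul, mul_comm]
    exact ((h1.add h2).add hFTO).congr_left fun q => by abel
  have hPt : Tendsto P (𝓝 p) (𝓝 (F p T)) := by
    simpa using (hPO.trans_tendsto hsub0).add_const (F p T)
  -- Since `f` vanishes at both `P q` and `F p T`, the value of `ℓ` is just the first-order
  -- remainder of `f`.
  have hℓP : HasFDerivAt (fun q => ℓ (P q - F p T)) (0 : Plane →L[ℝ] ℝ) p := by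
    have h1 : (fun q => f (P q) - f (F p T) - ℓ (P q - F p T)) =o[𝓝 p] fun q => q - p :=
      (hfd.isLittleO.comp_tendsto hPt).trans_isBigO hPO
    refine .of_isLittleO ?_
    refine h1.neg_left.congr' ?_ EventuallyEq.rfl
    filter_upwards [hgood] with q ⟨_, _, h3⟩
    have h4 : f (P q) = 0 := h3
    simp [hPp, hfT, h4]
  set E := Real.exp (∫ t in (0 : ℝ)..T, divergence Z (F p t)) with hE
  -- The time correction `(s q - T) • Y` is annihilated by `wedge Y`, so up to quadratic terms this
  -- is Liouville's formula at the fixed time `T`.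
  have hwP : HasFDerivAt (fun q => wedge Y (P q - F p T)) (E • wedgeL (Z p)) p := by
    obtain ⟨C₄, hC₄⟩ := exists_wedge_displacement_bound hZ hs hT0.le (a := F p)
      fun t ht => hF.deriv p t ⟨by linarith [ht.1], by linarith [ht.2]⟩
    have h1 : (fun q => wedge Y (F q T - F p T) - E * wedge (Z p) (q - p)) =O[𝓝 p]
        fun q => ‖q - p‖ ^ 2 := by
      refine IsBigO.of_bound C₄ (Eventually.of_forall fun q => ?_)
      have := hC₄ (F q) fun t ht => hF.deriv q t ⟨by linarith [ht.1], by linarith [ht.2]⟩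
      rw [hF.zero, hF.zero] at this
      rw [Real.norm_eq_abs, norm_pow, norm_norm]
      exact this
    have h2 : (fun q => wedge Y (P q - F q T - (s q - T) • Y)) =O[𝓝 p] fun q => ‖q - p‖ ^ 2 :=
      (IsBigO.of_bound ‖Y‖ (Eventually.of_forall fun q => abs_wedge_le _ _)).trans hrem
    have h3 := (IsBigO.hasFDerivAt (h1.add h2) (by norm_num)).add
      ((E • wedgeL (Z p)).hasFDerivAt.comp p (hasFDerivAt_sub_const p))
    rw [zero_add] at h3
    refine h3.congr_of_eventuallyEq (Eventually.of_forall fun q => ?_)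
    simp only [Pi.add_apply, Function.comp_apply, _root_.smul_apply, wedgeL_apply,
      smul_eq_mul]
    have h4 : wedge Y Y = 0 := by simp [wedge, mul_comm]
    have h5 : wedge Y (P q - F p T) =
        wedge Y (F q T - F p T) + wedge Y (P q - F q T - (s q - T) • Y) := by
      simp only [← wedgeL_apply, map_sub, map_smul]
      simp only [wedgeL_apply, h4, smul_zero]
      ring
    rw [h5]
    ring
  have hfinal : HasFDerivAt
      (fun q => (ℓ Y)⁻¹ • (ℓ (P q - F p T) • Y + wedge Y (P q - F p T) • kerVec ℓ) + F p T)
      ((ℓ Y)⁻¹ • ((0 : Plane →L[ℝ] ℝ).smulRight Y +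
        (E • wedgeL (Z p)).smulRight (kerVec ℓ))) p :=
    (((hℓP.smul_const Y).add (hwP.smul_const (kerVec ℓ))).const_smul (ℓ Y)⁻¹).add_const _
  have h0 : (0 : Plane →L[ℝ] ℝ).smulRight Y = 0 := by ext; simp
  rw [h0, zero_add] at hfinal
  refine hfinal.congr_of_eventuallyEq (Eventually.of_forall fun q => ?_)
  change P q = (ℓ Y)⁻¹ • (ℓ (P q - F p T) • Y + wedge Y (P q - F p T) • kerVec ℓ) + F p T
  rw [← smul_eq_add_kerVec, inv_smul_smul₀ hpos.ne', sub_add_cancel]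

end Flow

section Sewing

variable {M S : Set Plane} {X : Plane → Plane} {k : ℕ} [NeZero k]

/-! ### The transition maps -/

/-- After cutting off the smooth extension around both orbits, they coincide up to the shorter time.
A strictly longer orbit would then be in `W i`, off `S`, at the time when the other one arrives on
`S`. -/
theorem SewingOrbit.transition_unique (hM : IsOpen M) (hS : IsNormalCrossings M S)
    (γ : SewingOrbit M S X k) {i : Fin k} {q q₁ q₂ : Plane} (h₁ : γ.Transition i q q₁)
    (h₂ : γ.Transition i q q₂) : q₁ = q₂ := by
  obtain ⟨hq, hq₁, T₁, c₁, hT₁, hc₁, hs₁, he₁, hd₁⟩ := h₁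
  obtain ⟨-, hq₂, T₂, c₂, hT₂, hc₂, hs₂, he₂, hd₂⟩ := h₂
  wlog hT : T₁ ≤ T₂ generalizing T₁ T₂ c₁ c₂ q₁ q₂
  · exact (this hq₂ T₂ c₂ hT₂ hc₂ hs₂ he₂ hd₂ hq₁ T₁ c₁ hT₁ hc₁ hs₁ he₁ hd₁
      (le_of_not_ge hT)).symm
  have hWS := (γ.W_component i).subset
  have hsub : ∀ {T : ℝ} {c : ℝ → Plane}, c 0 ∈ S → c T ∈ S →
      (∀ t ∈ Ioo 0 T, c t ∈ γ.W i ∧ HasDerivAt c (X (c t)) t) → c '' Icc 0 T ⊆ M := by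
    rintro T c h0 hT hd _ ⟨t, ht, rfl⟩
    rcases ht.1.eq_or_lt with rfl | h1
    · exact hS.subset h0
    rcases ht.2.eq_or_lt with rfl | h2
    · exact hS.subset hT
    exact (hWS (hd t ⟨h1, h2⟩).1).1
  obtain ⟨Z, hZ, hZs, hZY⟩ := exists_compactSupport_eq_nhdsSet hM
    ((isCompact_Icc.image_of_continuousOn hc₁).union (isCompact_Icc.image_of_continuousOn hc₂))
    (union_subset (hsub (hs₁ ▸ hq) (he₁ ▸ hq₁) hd₁) (hsub (hs₂ ▸ hq) (he₂ ▸ hq₂) hd₂))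
    (γ.Xi_extension i).smooth
  have hZeq := fun y hy => hZY.self_of_nhdsSet y hy
  have hXZ₁ : ∀ t ∈ Ioo 0 T₁, HasDerivAt c₁ (Z (c₁ t)) t := fun t ht => by
    rw [hZeq _ (Or.inl (mem_image_of_mem _ (Ioo_subset_Icc_self ht))),
      ← (γ.Xi_extension i).eqOn (hd₁ t ht).1]
    exact (hd₁ t ht).2
  have hXZ₂ : ∀ t ∈ Ioo 0 T₂, HasDerivAt c₂ (Z (c₂ t)) t := fun t ht => by
    rw [hZeq _ (Or.inr (mem_image_of_mem _ (Ioo_subset_Icc_self ht))),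
      ← (γ.Xi_extension i).eqOn (hd₂ t ht).1]
    exact (hd₂ t ht).2
  have heq := eqOn_of_solutions hZ hZs hT₁ hc₁ hXZ₁ (hc₂.mono (Icc_subset_Icc_right hT))
    (fun t ht => hXZ₂ t (Ioo_subset_Ioo_right hT ht)) (hs₁.trans hs₂.symm)
    (right_mem_Icc.2 hT₁.le)
  rcases hT.eq_or_lt with rfl | hlt
  · rw [← he₁, ← he₂, heq]
  · refine absurd hq₁ ?_
    rw [← he₁, heq]
    exact (hWS (hd₂ T₁ ⟨hT₁, hlt⟩).1).2

/-- The transition map along an arc is defined near its starting point and differentiable there;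
its derivative on tangent vectors is given by the area form and the integral of the
divergence. -/
theorem SewingOrbit.exists_transition_map (hM : IsOpen M) (hS : IsNormalCrossings M S)
    (γ : SewingOrbit M S X k) (i : Fin k) :
    ∃ (P : Plane → Plane) (D : Plane →L[ℝ] Plane), P (γ.p i) = γ.p (i + 1) ∧
      HasFDerivAt P D (γ.p i) ∧ (∀ᶠ q in 𝓝 (γ.p i), q ∈ S → γ.Transition i q (P q)) ∧
      ∀ w, IsTangentAt M S (γ.p (i + 1)) w → w ≠ 0 →
        wedge (γ.Xi i (γ.p (i + 1))) w ≠ 0 ∧ ∀ v, D v =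
          (wedge (γ.Xi i (γ.p i)) v / wedge (γ.Xi i (γ.p (i + 1))) w *
            Real.exp (∫ t in (0 : ℝ)..(γ.T i), divergence (γ.Xi i) (γ.arc i t))) • w := by
  have hT := γ.T_pos i
  have hint := γ.arc_interior i
  have hW := γ.W_component i
  have hYX := (γ.Xi_extension i).eqOn
  have hstart := γ.arc_start i
  have hend := γ.arc_end i
  set T := γ.T i
  set a := γ.arc i
  set Y := γ.Xi i
  set p := γ.p i with hp
  set p' := γ.p (i + 1) with hp'
  have hK : IsCompact (a '' Icc 0 T) := isCompact_Icc.image_of_continuousOn (γ.arc_continuous i)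
  have hKM : a '' Icc 0 T ⊆ M := by
    rintro _ ⟨t, ht, rfl⟩
    rcases ht.1.eq_or_lt with rfl | h1
    · exact hS.subset (hstart ▸ γ.p_mem i)
    rcases ht.2.eq_or_lt with rfl | h2
    · exact hS.subset (hend ▸ γ.p_mem (i + 1))
    exact (hW.subset (hint t ⟨h1, h2⟩).1).1
  obtain ⟨Z, hZ, hZs, hZY⟩ := exists_compactSupport_eq_nhdsSet hM hK hKM (γ.Xi_extension i).smooth
  -- Agreement on an open set, and not only on the arc, is what makes the divergences agree too.
  obtain ⟨N₀, hN₀, hKN₀, hN₀Z⟩ := mem_nhdsSet_iff_exists.1 hZY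
  obtain ⟨N, hN, hKN, hNM, hNZ⟩ : ∃ N, IsOpen N ∧ a '' Icc 0 T ⊆ N ∧ N ⊆ M ∧ EqOn Z Y N :=
    ⟨N₀ ∩ M, hN₀.inter hM, subset_inter hKN₀ hKM, inter_subset_right, fun y hy => hN₀Z hy.1⟩
  obtain ⟨F, hF'⟩ := exists_flow hZ hZs (B := T + 1) (by linarith)
  have hF : IsFlow Z (T + 1) F := ⟨fun q => (hF' q).1, fun q => (hF' q).2⟩
  obtain ⟨K, hKL⟩ := hZ.lipschitzWith_of_hasCompactSupport hZs (by simp)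
  have hIB : ∀ t ∈ Icc 0 T, t ∈ Ioo (-(T + 1)) (T + 1) := fun t ht =>
    ⟨by linarith [ht.1], by linarith [ht.2]⟩
  have hFa : EqOn (F p) a (Icc 0 T) := by
    refine eqOn_of_solutions hZ hZs hT ((hF.continuousOn p).mono hIB)
      (fun t ht => hF.deriv p t (hIB t (Ioo_subset_Icc_self ht))) (γ.arc_continuous i)
      (fun t ht => ?_) (by rw [hF.zero, hstart])
    rw [hNZ (hKN (mem_image_of_mem _ (Ioo_subset_Icc_self ht))), ← hYX (hint t ht).1]
    exact (hint t ht).2.2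
  have hFN : ∀ t ∈ Icc 0 T, F p t ∈ N := fun t ht => by
    rw [hFa ht]
    exact hKN (mem_image_of_mem _ ht)
  have hF0 : F p 0 = p := hF.zero p
  have hFT : F p T = p' := (hFa (right_mem_Icc.2 hT.le)).trans hend
  have hpN : p ∈ N := hF0 ▸ hFN 0 (left_mem_Icc.2 hT.le)
  have hp'N : p' ∈ N := hFT ▸ hFN T (right_mem_Icc.2 hT.le)
  have hdiv : ∫ t in (0 : ℝ)..T, divergence Z (F p t) = ∫ t in (0 : ℝ)..T, divergence Y (a t) := by
    refine intervalIntegral.integral_congr fun t ht => ?_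
    rw [uIcc_of_le hT.le] at ht
    have h1 : Z =ᶠ[𝓝 (F p t)] Y := hNZ.eventuallyEq_of_mem (hN.mem_nhds (hFN t ht))
    rw [hFa ht] at h1
    simp only [divergence, hFa ht, h1.fderiv_eq]
  -- leaving the locus
  obtain ⟨U₀, f₀, hU₀, hpU₀, -, hf₀, hf₀p, hf₀S, hf₀Y, -⟩ := (γ.transverse_start i).exists_defining
  obtain ⟨η₀, hη₀, -, κ, hκ, hgrow⟩ := hF.exists_growth (p := p) hKL le_rfl (by linarith) hU₀ hf₀
    (by rwa [hF0]) (by rw [hF0, hNZ hpN]; exact hf₀Y)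
  -- landing on the locus
  obtain ⟨U₁, f₁, hU₁, hpU₁, -, hf₁, hf₁p, hf₁S, hf₁Y, hf₁t⟩ :=
    (γ.transverse_end i).exists_defining
  obtain ⟨s, hsp, hst, hsU, ⟨η₁, hη₁, hsneg⟩, hsd⟩ := hF.exists_landing (p := p) hZ hZs hT
    (by linarith) (hU₁.inter hN) (hf₁.mono inter_subset_left) (by rw [hFT]; exact ⟨hpU₁, hp'N⟩)
    (by rwa [hFT]) (by rw [hFT, hNZ hp'N]; exact hf₁Y)
  rw [hdiv, hFT, hNZ hpN, hNZ hp'N] at hsd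
  refine ⟨fun q => F q (s q), _, by simp only [hsp, hFT], hsd, ?_, ?_⟩
  · have hMS := hS.isOpen_diff hM
    set e₀ := min η₀ (T / 3)
    set e₁ := min η₁ (T / 3)
    have he₀ : 0 < e₀ := lt_min hη₀ (by linarith)
    have he₁ : 0 < e₁ := lt_min hη₁ (by linarith)
    have he₀' : e₀ ≤ η₀ := min_le_left _ _
    have he₁' : e₁ ≤ η₁ := min_le_left _ _
    -- Compactness keeps nearby orbits off `S` only away from the ends. Just after departure `f₀`
    -- has grown from 0, and just before landing `f₁` is negative.
    have hmid : ∀ᶠ q in 𝓝 p, ∀ t ∈ Icc e₀ (T - e₁), F q t ∈ M \ S := by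
      refine hF.eventually_mem hKL he₀.le (by linarith) hMS fun t ht => ?_
      have ht' : t ∈ Ioo 0 T := ⟨he₀.trans_le ht.1, by linarith [ht.2]⟩
      rw [hFa (Ioo_subset_Icc_self ht')]
      exact hW.subset (hint t ht').1
    have hN' : ∀ᶠ q in 𝓝 p, ∀ t ∈ Icc 0 T, F q t ∈ N :=
      hF.eventually_mem hKL le_rfl (by linarith) hN hFN
    -- The degenerate interval records one time spent in `W i`; connectedness extends this to the
    -- whole open orbit.
    have hhalf : ∀ᶠ q in 𝓝 p, ∀ t ∈ Icc (T / 2) (T / 2), F q t ∈ γ.W i := by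
      refine hF.eventually_mem hKL (by linarith) (by linarith) (hW.isOpen hMS) fun t ht => ?_
      have ht' : t ∈ Ioo 0 T := ⟨by linarith [ht.1], by linarith [ht.2]⟩
      rw [hFa (Ioo_subset_Icc_self ht')]
      exact (hint t ht').1
    filter_upwards [hmid, hN', hhalf, hgrow, hsU, hsneg,
      hst.eventually (Ioo_mem_nhds (show T / 2 < T by linarith) (show T < T + 1 by linarith))]
      with q h1 h2 h3 h4 h5 h6 h7 hqS
    have hs0 : 0 < s q := by linarith [h7.1]
    have hIs : ∀ t ∈ Icc 0 (s q), t ∈ Ioo (-(T + 1)) (T + 1) := fun t ht =>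
      ⟨by linarith [ht.1], by linarith [ht.2, h7.2]⟩
    have hNq : ∀ t ∈ Ioo 0 (s q), F q t ∈ N := fun t ht => by
      rcases le_total t T with h | h
      · exact h2 t ⟨ht.1.le, h⟩
      · exact (h6 t ⟨by linarith, ht.2⟩).1.2
    have hSq : ∀ t ∈ Ioo 0 (s q), F q t ∉ S := fun t ht => by
      rcases le_total t e₀ with h | h
      · have hI : t ∈ Icc (0 - η₀) (0 + η₀) := ⟨by linarith [ht.1], by linarith⟩
        have hI0 : (0 : ℝ) ∈ Icc (0 - η₀) (0 + η₀) := ⟨by linarith, by linarith⟩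
        have hg := h4.2 0 hI0 le_rfl t hI ht.1.le
        have hq0 : f₀ (F q 0) = 0 :=
          (hf₀S _ (h4.1 0 hI0 le_rfl)).1 ((hF.zero q).symm ▸ hqS)
        rw [hf₀S _ (h4.1 t hI ht.1.le)]
        have : 0 < κ * (t - 0) := mul_pos hκ (by linarith [ht.1])
        linarith
      rcases le_total t (T - e₁) with h' | h'
      · exact (h1 t ⟨h, h'⟩).2
      · obtain ⟨h8, h9⟩ := h6 t ⟨by linarith, ht.2⟩
        rw [hf₁S _ h8.1]
        exact h9.ne
    have hWq : F q '' Ioo 0 (s q) ⊆ γ.W i := by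
      refine hW.subset_of_isPreconnected (isPreconnected_Ioo.image _
        ((hF.continuousOn q).mono fun t ht => hIs t (Ioo_subset_Icc_self ht))) ?_
        ⟨F q (T / 2), mem_image_of_mem _ ⟨by linarith, h7.1⟩, h3 _ ⟨le_rfl, le_rfl⟩⟩
      rintro _ ⟨t, ht, rfl⟩
      exact ⟨hNM (hNq t ht), hSq t ht⟩
    refine ⟨hqS, (hf₁S _ h5.1.1).2 h5.2, s q, F q, hs0, (hF.continuousOn q).mono hIs, hF.zero q,
      rfl, fun t ht => ?_⟩
    have hWt := hWq (mem_image_of_mem _ ht)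
    refine ⟨hWt, ?_⟩
    rw [hYX hWt, ← hNZ (hNq t ht)]
    exact hF.deriv q t (hIs t (Ioo_subset_Icc_self ht))
  · intro w hw hw0
    obtain ⟨z, hz0, hz, hzS⟩ := hw.exists_curve
    have hlw := hf₁t z w hz0 hz hzS
    -- Rewriting `kerVec` as a multiple of `w` cancels the derivative of `f₁` along the field, so
    -- the formula no longer depends on the defining function.
    obtain ⟨h1, h2⟩ := eq_smul_of_mem_ker hf₁Y.ne' hlw hw0 (apply_kerVec _)
    refine ⟨h1, fun v => ?_⟩
    rw [wedge_kerVec] at h2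
    have h3 : fderiv ℝ f₁ p' (Y p') ≠ 0 := hf₁Y.ne'
    change kerVec (fderiv ℝ f₁ p') = (fderiv ℝ f₁ p' (Y p') / wedge (Y p') w) • w at h2
    change wedge (Y p') w ≠ 0 at h1
    rw [_root_.smul_apply, ContinuousLinearMap.smulRight_apply, h2, smul_smul, smul_smul]
    congr 1
    simp only [_root_.smul_apply, wedgeL_apply, smul_eq_mul]
    field_simp

/-! ### The sewing Poincaré map -/

theorem SewingOrbit.sewingReturn_unique (hM : IsOpen M) (hS : IsNormalCrossings M S)
    (γ : SewingOrbit M S X k) {q q₁ q₂ : Plane} (h₁ : γ.SewingReturn q q₁)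
    (h₂ : γ.SewingReturn q q₂) : q₁ = q₂ := by
  obtain ⟨z₁, hs₁, he₁, ht₁⟩ := h₁
  obtain ⟨z₂, hs₂, he₂, ht₂⟩ := h₂
  have : ∀ j, z₁ j = z₂ j := by
    intro j
    induction j using Fin.induction with
    | zero => rw [hs₁, hs₂]
    | succ j ih => exact γ.transition_unique hM hS (ht₁ j) (ih ▸ ht₂ j)
  rw [← he₁, ← he₂, this]

/-- The chosen value is forced by uniqueness of the sewing return and injectivity of `σ`; the branch
of positive parameter is void at 0. -/
theorem SewingOrbit.regPoincare_zero_eq (hM : IsOpen M) (hS : IsNormalCrossings M S)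
    (γ : SewingOrbit M S X k) (m : Plane → ℝ) {σ : ℝ → Plane} {δ : ℝ}
    (hσ : InjOn σ (Ioo (-δ) δ)) {x y : ℝ} (hx : x ∈ Ioo (-δ) δ) (hy : y ∈ Ioo (-δ) δ)
    (h : γ.SewingReturn (σ x) (σ y)) : γ.regPoincare m σ δ x 0 = y := by
  have hex : ∃ y, γ.RegReturn m σ δ x 0 y := ⟨y, hx, hy, Or.inl ⟨rfl, h⟩⟩
  rw [SewingOrbit.regPoincare, dif_pos hex]
  obtain ⟨-, h1, ⟨-, h2⟩ | ⟨h2, -⟩⟩ := hex.choose_spec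
  · exact hσ h1 hy (γ.sewingReturn_unique hM hS h2 h)
  · exact absurd h2 (lt_irrefl _)

/-- A velocity of a curve in the locus through `p i` is a multiple of any tangent vector. -/
theorem SewingOrbit.exists_eq_smul_tangent (γ : SewingOrbit M S X k) {i : Fin k} {w v : Plane}
    (hw : IsTangentAt M S (γ.p i) w) (hw0 : w ≠ 0) {z : ℝ → Plane} (hz0 : z 0 = γ.p i)
    (hz : HasDerivAt z v 0) (hzS : ∀ᶠ s in 𝓝 0, z s ∈ S) : ∃ c : ℝ, v = c • w := by
  obtain ⟨U, f, -, -, -, -, -, -, hfY, hft⟩ := (γ.transverse_start i).exists_defining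
  obtain ⟨z', hz'0, hz', hz'S⟩ := hw.exists_curve
  exact ⟨_, (eq_smul_of_mem_ker hfY.ne' (hft z' w hz'0 hz' hz'S) hw0 (hft z v hz0 hz hzS)).2⟩

end Sewing

end PlanarSewing

end

/-! ### The derivative of the sewing return map in the section coordinate -/

open PlanarSewing Filter Topology in
theorem mainTheorem6
    (M S : Set PlanarSewing.Plane) (hM : IsOpen M)
    (hS : PlanarSewing.IsNormalCrossings M S)
    (X : PlanarSewing.Plane → PlanarSewing.Plane)
    (hX : PlanarSewing.IsPiecewiseSmooth M S X)
    (m : PlanarSewing.Plane → ℝ) (hm : PlanarSewing.IsMollifier m)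
    (k : ℕ) [NeZero k] (γ : PlanarSewing.SewingOrbit M S X k)
    (σ : ℝ → PlanarSewing.Plane) (δ : ℝ) (hσ : PlanarSewing.IsSectionParam γ σ δ)
    (τ : Fin k → PlanarSewing.Plane)
    (hτ : ∀ i, ‖τ i‖ = 1 ∧ PlanarSewing.IsTangentAt M S (γ.p i) (τ i)) :
    HasDerivAt (fun x : ℝ => γ.regPoincare m σ δ x 0)
      (∏ i : Fin k,
        (‖γ.Xi i (γ.p i)‖ * (γ.angleIn τ i).sin) /
            (‖γ.Xi i (γ.p (i + 1))‖ * (γ.angleOut τ i).sin) *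
          Real.exp (∫ t in (0 : ℝ)..(γ.T i),
            PlanarSewing.divergence (γ.Xi i) (γ.arc i t))) 0 := by
  have hI : Set.Ioo (-δ) δ ∈ 𝓝 (0 : ℝ) := Ioo_mem_nhds (by linarith [hσ.pos]) hσ.pos
  have hI0 : (0 : ℝ) ∈ Set.Ioo (-δ) δ := mem_of_mem_nhds hI
  have hτ0 : ∀ i, τ i ≠ 0 := fun i h => by simpa [h] using (hτ i).1
  choose P D hPp hPd hPt hPw using fun i => γ.exists_transition_map hM hS i
  set fac : Fin k → ℝ := fun i => (‖γ.Xi i (γ.p i)‖ * (γ.angleIn τ i).sin) /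
            (‖γ.Xi i (γ.p (i + 1))‖ * (γ.angleOut τ i).sin) *
          Real.exp (∫ t in (0 : ℝ)..(γ.T i),
            PlanarSewing.divergence (γ.Xi i) (γ.arc i t)) with hfac
  -- The transition formula has the field in the first slot of the area form and the angles have it
  -- in the second; the two signs cancel in the quotient.
  have hDτ : ∀ i, D i (τ i) = fac i • τ (i + 1) := by
    intro i
    rw [(hPw i _ (hτ (i + 1)).2 (hτ0 _)).2, hfac]
    simp only [SewingOrbit.angleIn, SewingOrbit.angleOut]
    rw [norm_mul_sin_oangle (hτ i).1, norm_mul_sin_oangle (hτ (i + 1)).1,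
      wedge_swap (τ i), wedge_swap (τ (i + 1)), neg_div_neg_eq]
  have hσd : HasDerivAt σ (deriv σ 0) 0 :=
    ((hσ.smooth.contDiffAt hI).differentiableAt (by simp)).hasDerivAt
  obtain ⟨a, ha⟩ := γ.exists_eq_smul_tangent (hτ 0).2 (hτ0 0) hσ.base hσd
    (by filter_upwards [hI] with x hx using hσ.mapsTo hx)
  -- the iterated transition maps
  set ι : ℕ → Fin k := fun n => Fin.ofNat k n with hι
  have hι0 : ι 0 = 0 := rfl
  have hιs : ∀ n, ι (n + 1) = ι n + 1 := fun n => by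
    apply Fin.ext
    simp [hι, Fin.val_add]
  have hιk : ι k = 0 := by
    apply Fin.ext
    simp [hι]
  have hιi : ∀ i : Fin k, ι i = i := fun i => by
    apply Fin.ext
    simp [hι]
  set g : ℕ → ℝ → Plane := fun n => Nat.rec σ (fun n h x => P (ι n) (h x)) n with hg
  have hgs : ∀ n x, g (n + 1) x = P (ι n) (g n x) := fun n x => rfl
  -- Membership in `S` is carried along because `P` represents the transition only at points of `S`.
  -- At `n = k` the index wraps to 0, so the final velocity is a multiple of `deriv σ 0`.
  have key : ∀ n, g n 0 = γ.p (ι n) ∧ (∀ᶠ x in 𝓝 0, g n x ∈ S) ∧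
      HasDerivAt (g n) ((∏ j ∈ Finset.range n, fac (ι j)) • a • τ (ι n)) 0 := by
    intro n
    induction n with
    | zero =>
      refine ⟨hσ.base, ?_, ?_⟩
      · filter_upwards [hI] with x hx using hσ.mapsTo hx
      · rw [Finset.range_zero, Finset.prod_empty, one_smul, hι0, ← ha]
        exact hσd
    | succ n ih =>
      obtain ⟨h0, h1, h2⟩ := ih
      refine ⟨by rw [hgs, h0, hPp, hιs], ?_, ?_⟩
      · have := h2.continuousAt.eventually (h0 ▸ hPt (ι n))
        filter_upwards [h1, this] with x hx hx'
        exact (hx' hx).2.1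
      · have h3 := (hPd (ι n)).comp_hasDerivAt_of_eq 0 h2 h0.symm
        refine h3.congr_deriv ?_
        rw [map_smul, map_smul, hDτ, hιs, Finset.prod_range_succ, smul_smul, smul_smul, smul_smul]
        congr 1
        ring
  have htrans : ∀ n, ∀ᶠ x in 𝓝 0, γ.Transition (ι n) (g n x) (g (n + 1) x) := by
    intro n
    obtain ⟨h0, h1, h2⟩ := key n
    have := h2.continuousAt.eventually (h0 ▸ hPt (ι n))
    filter_upwards [h1, this] with x hx hx' using hx' hx
  have hret : ∀ᶠ x in 𝓝 0, γ.SewingReturn (σ x) (g k x) := by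
    have : ∀ᶠ x in 𝓝 0, ∀ i : Fin k, γ.Transition (ι i) (g i x) (g (i + 1) x) :=
      eventually_all.2 fun i => htrans i
    filter_upwards [this] with x hx
    refine ⟨fun j => g j x, rfl, by simp, fun i => ?_⟩
    have := hx i
    rw [hιi] at this
    exact this
  -- reading the return map in the coordinate of the section
  obtain ⟨φ, hφ, -⟩ := (hτ 0).2
  obtain ⟨ρ, hρd, hρS, hρσ⟩ := hφ.exists_section_inverse hσ.pos hσ.smooth (hσ.regular 0 hI0)
    hσ.mapsTo hσ.base
  obtain ⟨hk0, hkS, hkd⟩ := key k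
  rw [hιk, ← ha] at hkd
  rw [hιk] at hk0
  -- Differentiating `ρ ∘ σ = id` normalizes the coordinate, so the scalar `a` drops out and only
  -- the product remains.
  have hρ1 : fderiv ℝ ρ (γ.p 0) (deriv σ 0) = 1 := by
    have h1 := hρd.hasFDerivAt.comp_hasDerivAt_of_eq 0 hσd hσ.base.symm
    exact h1.unique ((hasDerivAt_id (0 : ℝ)).congr_of_eventuallyEq hρσ)
  have hfin := hρd.hasFDerivAt.comp_hasDerivAt_of_eq 0 hkd hk0.symm
  rw [map_smul, hρ1, smul_eq_mul, mul_one, Finset.prod_range (fun n => fac (ι n))] at hfin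
  simp only [hιi] at hfin
  refine hfin.congr_of_eventuallyEq ?_
  have hkρ := hkd.continuousAt.eventually (hk0 ▸ hρS)
  filter_upwards [hret, hI, hkS, hkρ] with x h1 h2 h3 h4
  obtain ⟨h5, h6⟩ := h4 h3
  exact γ.regPoincare_zero_eq hM hS m hσ.injOn h2 h5 (by rw [Function.comp_apply, h6]; exact h1)
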